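/- All graphs are simple. Two edges of a graph $G$ are \emph{parallel} if they are joined by a finite sequence of edges in which any two consecutive edges are opposite edges of a $4$-cycle; a \emph{hyperplane} is a parallelism class of edges, and the \emph{halfspaces} it delimits are the connected components of the graph obtained from $G$ by removing its edges. A map between graphs is \emph{parallel-preserving} if it sends vertices to vertices, edges to edges, and parallel edges to parallel edges. A connected graph is \emph{median} if any three vertices $x_1,x_2,x_3$ admit a unique vertex $m$ with $d(x_i,x_j)=d(x_i,m)+d(m,x_j)$ for all $i\neq j$. The \emph{hypercube} on a set $S$ is the graph whose vertices are the finite subsets of $S$, two of them being adjacent when their symmetric difference has size one. A connected graph is \emph{submedian} if it embeds into a hypercube (not necessarily as an induced subgraph) and if its square-completion, i.e. the square complex obtained by filling all its $4$-cycles with squares, is simply connected. A \emph{wallspace} is a set $P$ with a collection $\mathcal{W}$ of \emph{walls}, i.e. partitions $W=\{A,B\}$ of $P$ into two nonempty pieces (\emph{halfspaces}), such that any two points are separated by only finitely many walls. An \emph{orientation} is a map $\sigma$ on $\mathcal{W}$ with $\sigma(W)\in W$ for every $W$ and $\sigma(U)\cap\sigma(W)\neq\emptyset$ for all $U,W$;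 it is \emph{principal} if, for some $x\in P$, every $\sigma(W)$ is the halfspace of $W$ containing $x$. The \emph{cubulation} of $(P,\mathcal{W})$ is the graph whose vertices are the orientations that differ from a principal one on only finitely many walls, two of them being adjacent when they differ on exactly one wall. The canonical map sends a point to the principal orientation it defines. \textbf{Proposition.} Let $X$ be a submedian graph, $Y$ a median graph, and $\psi : X \to Y$ a parallel-preserving map. The pairs of halfspaces delimited by the hyperplanes of $X$ define a wallspace structure on the vertex set of $X$; let $M(X)$ denote its cubulation. The canonical map $\eta : X \to M(X)$ is a graph embedding (an injective map sending edges to edges). Moreover, there exists a unique parallel-preserving map $\xi : M(X)\to Y$ such that $\psi = \xi\circ\eta$. -/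

import Mathlib

universe u

namespace MedianGraph

open scoped unitInterval

/-! ### Parallelism, hyperplanes, parallel-preserving maps -/

/-- A `4`-cycle of `G`, given by its vertices `a, b, c, d` in cyclic order. -/
structure FourCycle {V : Type*} (G : SimpleGraph V) where
  a : V
  b : V
  c : V
  d : V
  adj_ab : G.Adj a b
  adj_bc : G.Adj b c
  adj_cd : G.Adj c d
  adj_da : G.Adj d a
  ne_ac : a ≠ c
  ne_bd : b ≠ d

/-- The same `4`-cycle, read from its second vertex. -/
def FourCycle.rotate {V : Type*} {G : SimpleGraph V} (Q : FourCycle G) : FourCycle G where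
  a := Q.b
  b := Q.c
  c := Q.d
  d := Q.a
  adj_ab := Q.adj_bc
  adj_bc := Q.adj_cd
  adj_cd := Q.adj_da
  adj_da := Q.adj_ab
  ne_ac := Q.ne_bd
  ne_bd := Q.ne_ac.symm

/-- The same `4`-cycle, read in the reverse direction. -/
def FourCycle.reflect {V : Type*} {G : SimpleGraph V} (Q : FourCycle G) : FourCycle G where
  a := Q.a
  b := Q.d
  c := Q.c
  d := Q.b
  adj_ab := Q.adj_da.symm
  adj_bc := Q.adj_cd.symm
  adj_cd := Q.adj_bc.symm
  adj_da := Q.adj_ab.symm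
  ne_ac := Q.ne_ac
  ne_bd := Q.ne_bd.symm

/-- The edges `e` and `f` are opposite edges in a `4`-cycle of `G`. (Since a `4`-cycle may be read
from any of its vertices, every pair of opposite edges has this form.) -/
def Opposite {V : Type*} (G : SimpleGraph V) (e f : Sym2 V) : Prop :=
  ∃ Q : FourCycle G, e = s(Q.a, Q.b) ∧ f = s(Q.c, Q.d)

/-- Two edges are parallel if they are joined by a finite sequence of edges, any two consecutive
ones being opposite edges in a `4`-cycle. -/
def Parallel {V : Type*} (G : SimpleGraph V) (e f : Sym2 V) : Prop :=
  e ∈ G.edgeSet ∧ f ∈ G.edgeSet ∧ Relation.ReflTransGen (Opposite G) e f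

/-- A hyperplane is a parallelism class of edges. -/
def IsHyperplane {V : Type*} (G : SimpleGraph V) (J : Set (Sym2 V)) : Prop :=
  ∃ e ∈ G.edgeSet, J = {f | Parallel G e f}

/-- The halfspaces delimited by `J`: the (vertex sets of the) connected components of the graph
obtained from `G` by removing the edges in `J`. -/
def halfspaces {V : Type*} (G : SimpleGraph V) (J : Set (Sym2 V)) : Set (Set V) :=
  {A | ∃ C : (G.deleteEdges J).ConnectedComponent, A = C.supp}

/-- A graph homomorphism (which sends vertices to vertices and edges to edges) is
parallel-preserving if it sends parallel edges to parallel edges. -/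
def ParallelPreserving {V W : Type*} {G : SimpleGraph V} {H : SimpleGraph W} (f : G →g H) : Prop :=
  ∀ e e' : Sym2 V, Parallel G e e' → Parallel H (e.map f) (e'.map f)

/-! ### Median graphs and hypercubes -/

/-- A median graph: a connected graph in which any three vertices have a unique median. -/
def IsMedian {V : Type*} (G : SimpleGraph V) : Prop :=
  G.Connected ∧ ∀ x₁ x₂ x₃ : V, ∃! m : V,
    G.dist x₁ x₂ = G.dist x₁ m + G.dist m x₂ ∧
    G.dist x₁ x₃ = G.dist x₁ m + G.dist m x₃ ∧
    G.dist x₂ x₃ = G.dist x₂ m + G.dist m x₃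

/-- The hypercube on `S`: the vertices are the finite subsets of `S`, two of them being adjacent
when their symmetric difference has size one. -/
def hypercube (S : Type*) : SimpleGraph (Finset S) where
  Adj A B := (symmDiff (A : Set S) (B : Set S)).ncard = 1
  symm := ⟨fun A B h => by rw [symmDiff_comm]; exact h⟩
  loopless := ⟨fun A h => by simp at h⟩

/-! ### The square-completion -/

/-- The disjoint union of the cells: a point for each vertex, an interval for each oriented edge,
a square `[0, 1]²` for each `4`-cycle read from one of its vertices in one of the two directions.
The repeated copies of an edge or of a `4`-cycle are identified below. The parameter `t` on the
oriented edge `(a, b)` runs from `a` at `0` to `b` at `1`; the corners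
`(0, 0), (1, 0), (1, 1), (0, 1)` of the square of the `4`-cycle `a, b, c, d` are `a, b, c, d`. -/
abbrev Cells {V : Type*} (G : SimpleGraph V) : Type _ :=
  (Σ _ : V, Unit) ⊕ (Σ _ : G.Dart, I) ⊕ (Σ _ : FourCycle G, I × I)

/-- The point of a vertex. -/
def vertexPt {V : Type*} {G : SimpleGraph V} (v : V) : Cells G := Sum.inl ⟨v, ()⟩

/-- The points of an oriented edge. -/
def edgePt {V : Type*} {G : SimpleGraph V} (e : G.Dart) (t : I) : Cells G :=
  Sum.inr (Sum.inl ⟨e, t⟩)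

/-- The points of the square of a `4`-cycle. -/
def squarePt {V : Type*} {G : SimpleGraph V} (Q : FourCycle G) (s t : I) : Cells G :=
  Sum.inr (Sum.inr ⟨Q, (s, t)⟩)

/-- The gluing of the cells: the endpoints of an edge are glued to the corresponding vertices, the
sides of a square to the corresponding edges, and the various parametrizations of the same edge or
the same square are identified. -/
inductive Glue {V : Type*} (G : SimpleGraph V) : Cells G → Cells G → Prop
  | edge_start (e : G.Dart) : Glue G (edgePt e 0) (vertexPt e.fst)
  | edge_reverse (e : G.Dart) (t : I) : Glue G (edgePt e t) (edgePt e.symm (σ t))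
  | square_side (Q : FourCycle G) (s : I) :
      Glue G (squarePt Q s 0) (edgePt ⟨(Q.a, Q.b), Q.adj_ab⟩ s)
  | square_rotate (Q : FourCycle G) (s t : I) :
      Glue G (squarePt Q s t) (squarePt Q.rotate t (σ s))
  | square_reflect (Q : FourCycle G) (s t : I) :
      Glue G (squarePt Q s t) (squarePt Q.reflect t s)

/-- The square-completion of a graph, obtained by filling all its `4`-cycles with squares: a
topological space with the quotient (i.e. weak) topology. -/
abbrev SquareCompletion {V : Type*} (G : SimpleGraph V) : Type _ := Quot (Glue G)

/-- A submedian graph: a connected graph that embeds in a hypercube (not necessarily as an induced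
subgraph) and has a simply connected square-completion. -/
def IsSubmedian {V : Type u} (G : SimpleGraph V) : Prop :=
  G.Connected ∧
  (∃ (S : Type u) (f : G →g hypercube S), Function.Injective f) ∧
  SimplyConnectedSpace (SquareCompletion G)

/-! ### Wallspaces and cubulations -/

/-- The pair of subsets `W` separates `x` and `y`. -/
def Separates {P : Type*} (W : Set (Set P)) (x y : P) : Prop :=
  ∃ A B : Set P, W = {A, B} ∧ x ∈ A ∧ y ∈ B

/-- A wallspace structure on a set `P`: a collection of partitions `{A, B}` of `P` into two
nonempty pieces such that any two points are separated by only finitely many of them. -/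
@[ext]
structure Wallspace (P : Type*) where
  walls : Set (Set (Set P))
  partition : ∀ W ∈ walls, ∃ A B : Set P,
    W = {A, B} ∧ A.Nonempty ∧ B.Nonempty ∧ A ∪ B = Set.univ ∧ A ∩ B = ∅
  finite_separating : ∀ x y : P, {W | W ∈ walls ∧ Separates W x y}.Finite

/-- An orientation: a choice of a halfspace of each wall, any two of them intersecting. -/
@[ext]
structure Orientation {P : Type*} (ω : Wallspace P) where
  toFun : ω.walls → Set P
  mem : ∀ W : ω.walls, toFun W ∈ (W : Set (Set P))
  inter : ∀ U W : ω.walls, (toFun U ∩ toFun W).Nonempty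

/-- The halfspace of the wall `W` that contains `x`. -/
def halfspaceAt {P : Type*} (W : Set (Set P)) (x : P) : Set P :=
  {y | ∃ A ∈ W, x ∈ A ∧ y ∈ A}

theorem halfspaceAt_mem {P : Type*} (ω : Wallspace P) (W : ω.walls) (x : P) :
    halfspaceAt (W : Set (Set P)) x ∈ (W : Set (Set P)) ∧ x ∈ halfspaceAt (W : Set (Set P)) x := by
  obtain ⟨A, B, hW, -, -, hAB, hd⟩ := ω.partition W W.2
  have key : ∀ C D : Set P, (W : Set (Set P)) = {C, D} → C ∩ D = ∅ → x ∈ C →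
      halfspaceAt (W : Set (Set P)) x = C := by
    intro C D h hCD hx
    ext y
    simp only [halfspaceAt, h, Set.mem_insert_iff, Set.mem_singleton_iff, exists_eq_or_imp,
      exists_eq_left, Set.mem_ofPred_eq]
    constructor
    · rintro (h1 | h1)
      · exact h1.2
      · have h2 : x ∈ C ∩ D := ⟨hx, h1.1⟩
        rw [hCD] at h2
        exact h2.elim
    · exact fun hy => Or.inl ⟨hx, hy⟩
  have hx : x ∈ A ∪ B := by rw [hAB]; trivial
  rcases hx with hx | hx
  · rw [key A B hW hd hx, hW]
    exact ⟨by simp, hx⟩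
  · rw [key B A (by rw [hW, Set.pair_comm]) (by rw [Set.inter_comm, hd]) hx, hW]
    exact ⟨by simp, hx⟩

/-- The principal orientation given by the point `x`. -/
def principal {P : Type*} (ω : Wallspace P) (x : P) : Orientation ω where
  toFun W := halfspaceAt (W : Set (Set P)) x
  mem W := (halfspaceAt_mem ω W x).1
  inter U W := ⟨x, (halfspaceAt_mem ω U x).2, (halfspaceAt_mem ω W x).2⟩

/-- The vertices of the cubulation: the orientations that differ from a principal one on only
finitely many walls. -/
def CubulationVertex {P : Type*} (ω : Wallspace P) : Type _ :=
  {τ : Orientation ω // ∃ x : P, {W | τ.toFun W ≠ (principal ω x).toFun W}.Finite}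

/-- The cubulation of a wallspace: two orientations are adjacent when they differ on a single
wall. -/
def cubulation {P : Type*} (ω : Wallspace P) : SimpleGraph (CubulationVertex ω) where
  Adj μ ν := ∃! W : ω.walls, μ.1.toFun W ≠ ν.1.toFun W
  symm := ⟨fun μ ν h => by simpa only [ne_comm] using h⟩
  loopless := ⟨fun μ h => by simp [ExistsUnique] at h⟩

/-- The canonical map from a wallspace to its cubulation. -/
def canonicalMap {P : Type*} (ω : Wallspace P) (x : P) : CubulationVertex ω :=
  ⟨principal ω x, x, by simp⟩

/-- The walls of a graph: the pieces of the wall of a hyperplane are the halfspaces that it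
delimits. -/
def hyperplaneWalls {V : Type*} (G : SimpleGraph V) : Set (Set (Set V)) :=
  {W | ∃ J, IsHyperplane G J ∧ W = halfspaces G J}

end MedianGraph

namespace MedianGraph

open scoped unitInterval

/-! Simple connectivity enters only through cohomology: an integral cochain on the edges of `X` that
agrees on opposite sides of every 4-cycle is a coboundary (`exists_potential`). Embed `X` in a
hypercube. Opposite sides of a 4-cycle flip the same coordinate, so the coboundary of a coordinate,
restricted to one hyperplane `J`, is such a cocycle. Its potential is constant on the components of
`X` minus `J` and, for the coordinate flipped by a given edge of `J`, jumps across that edge; so `J`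
separates. Sliding edges across squares shows that there are only two components. Summing the
potentials over the hyperplanes met by a path recovers the increments of the coordinate, so the
hyperplanes separate vertices and η is injective.

In M(X), one orientation is turned into another by flipping, one at a time, walls with minimal
halfspaces. Hence M(X) is connected and its parallelism classes correspond to the walls, each wall
being flipped by some edge of η(X). In the median graph `Y`, a vertex has at most one neighbour
across a given hyperplane. So ξ, known on η(X), is forced along every path of M(X): this is
uniqueness.

For existence, fix x₀. The vertex ξ(μ) should be reached from ψ(x₀) by crossing the images of the
walls that separate μ from x₀. Several walls may have the same image, so only parities count
(`Extends`). Halfspaces separate the vertices of `Y`, so at most one vertex fits; that one exists is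
propagated along the edges of M(X). When μ flips `J`, an edge of the image of `J` is needed at the
current vertex y. If xx' crosses `J`, with ψ(x) on the side of y,
`IsMedian.exists_adj_notMem_nearer` asks that every halfspace containing y but not ψ(x) reach beyond
the image of `J`. Such a halfspace is bounded by the image of a wall `U` on which μ and x disagree;
since `J` can be flipped at μ, `J` and `U` cross in a 4-cycle of `X`
(`IsSubmedian.exists_fourCycle`), whose image has a vertex where it is needed. -/

instance : LocallyPathConnectedSpace I :=
  (isQuotientMap_projIcc (a := (0 : ℝ)) (b := 1) (h := zero_le_one)).locallyPathConnectedSpace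

/-! ### Integral cocycles on the square-completion -/

section Topology

variable {V : Type*} {G : SimpleGraph V}

/-- The real number attached to a point of a cell by an integral cochain. -/
def cellHeight (c : V → V → ℤ) : Cells G → ℝ
  | .inl _ => 0
  | .inr (.inl ⟨e, t⟩) => c e.fst e.snd * (t : ℝ)
  | .inr (.inr ⟨Q, (s, t)⟩) => c Q.a Q.b * (s : ℝ) + c Q.a Q.d * (t : ℝ)

theorem continuous_cellHeight (c : V → V → ℤ) : Continuous (cellHeight (G := G) c) := by
  refine continuous_sum_dom.2 ⟨continuous_const, continuous_sum_dom.2 ⟨?_, ?_⟩⟩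
  · refine continuous_sigma fun e => ?_
    change Continuous fun t : I => (c e.fst e.snd : ℝ) * (t : ℝ)
    fun_prop
  · refine continuous_sigma fun Q => ?_
    change Continuous fun p : I × I => (c Q.a Q.b : ℝ) * (p.1 : ℝ) + c Q.a Q.d * (p.2 : ℝ)
    fun_prop

/-- Reversing an edge or rotating a square shifts the affine height by an integer, so the height is
well defined on the square-completion modulo 1. -/
theorem coe_cellHeight_eq_of_glue {c : V → V → ℤ} (hc : ∀ a b, c b a = -c a b)
    (hQ : ∀ Q : FourCycle G, c Q.a Q.b = c Q.d Q.c) {x y : Cells G} (h : Glue G x y) :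
    (cellHeight c x : AddCircle (1 : ℝ)) = cellHeight c y := by
  have key : ∀ (u v : ℝ) (n : ℤ), u = v + n → (u : AddCircle (1 : ℝ)) = v := by
    rintro u v n rfl
    have : ((n : ℝ) : AddCircle (1 : ℝ)) = 0 := (AddCircle.coe_eq_zero_iff 1).2 ⟨n, by simp⟩
    rw [AddCircle.coe_add, this, add_zero]
  cases h with
  | edge_start e => exact key _ _ 0 (by simp [cellHeight, edgePt, vertexPt])
  | edge_reverse e t =>
    refine key _ _ (c e.fst e.snd) ?_
    have := hc e.fst e.snd
    simp only [cellHeight, edgePt, SimpleGraph.Dart.symm, Prod.fst_swap, Prod.snd_swap, this,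
      unitInterval.coe_symm_eq]
    push_cast
    ring
  | square_side Q s => exact key _ _ 0 (by simp [cellHeight, squarePt, edgePt])
  | square_rotate Q s t =>
    refine key _ _ (c Q.a Q.b) ?_
    have h1 := hc Q.a Q.b
    have h2 := hQ Q.rotate
    have h3 := hc Q.a Q.d
    simp only [FourCycle.rotate] at h2
    simp only [cellHeight, squarePt, FourCycle.rotate, h1, h2, unitInterval.coe_symm_eq]
    push_cast
    ring
  | square_reflect Q s t =>
    exact key _ _ 0 (by simp [cellHeight, squarePt, FourCycle.reflect, add_comm])

/-- On a simply connected square-completion, every integral cocycle is a coboundary. -/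
theorem exists_potential [SimplyConnectedSpace (SquareCompletion G)] {c : V → V → ℤ}
    (hc : ∀ a b, c b a = -c a b) (hQ : ∀ Q : FourCycle G, c Q.a Q.b = c Q.d Q.c) :
    ∃ h : V → ℤ, ∀ a b, G.Adj a b → h b - h a = c a b := by
  let f : C(SquareCompletion G, AddCircle (1 : ℝ)) :=
    ⟨Quot.lift (fun x => (cellHeight c x : AddCircle (1 : ℝ)))
      fun _ _ h => coe_cellHeight_eq_of_glue hc hQ h,
      continuous_quot_lift _ ((AddCircle.continuous_mk' 1).comp (continuous_cellHeight c))⟩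
  obtain ⟨x₀⟩ : Nonempty (SquareCompletion G) := inferInstance
  obtain ⟨r, hr⟩ := QuotientAddGroup.mk_surjective (f x₀)
  -- Lift the circle-valued height to ℝ. Local path connectedness, needed here, passes from `I` to
  -- the disjoint union of the cells and to its quotient.
  obtain ⟨F, ⟨-, hF⟩, -⟩ :=
    (AddCircle.isCoveringMap_coe (1 : ℝ)).existsUnique_continuousMap_lifts f x₀ r hr
  have hF' : ∀ x : Cells G, ∃ n : ℤ, F (Quot.mk _ x) - cellHeight c x = n := by
    intro x
    have h1 : ((F (Quot.mk _ x) : ℝ) : AddCircle (1 : ℝ)) = cellHeight c x :=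
      congrFun hF (Quot.mk _ x)
    rw [← sub_eq_zero, ← AddCircle.coe_sub] at h1
    obtain ⟨n, hn⟩ := (AddCircle.coe_eq_zero_iff 1).1 h1
    exact ⟨n, by rw [← hn]; simp⟩
  have hv : ∀ v : V, ∃ n : ℤ, F (Quot.mk _ (vertexPt v)) = n := by
    intro v
    obtain ⟨n, hn⟩ := hF' (vertexPt v)
    exact ⟨n, by simpa [cellHeight, vertexPt] using hn⟩
  choose h hh using hv
  refine ⟨h, fun a b hab => ?_⟩
  let e : G.Dart := ⟨(a, b), hab⟩
  choose n hn using fun t : I => hF' (edgePt e t)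
  have hcont : Continuous n := by
    have : Continuous fun t : I => ((n t : ℤ) : ℝ) := by
      simp_rw [← hn]
      have he : Continuous fun t : I => (edgePt e t : Cells G) := by
        exact continuous_inr.comp (continuous_inl.comp continuous_sigmaMk)
      exact (F.continuous.comp (continuous_quot_mk.comp he)).sub
        ((continuous_cellHeight c).comp he)
    exact Int.isClosedEmbedding_coe_real.isEmbedding.continuous_iff.2 this
  -- Along an edge the lift differs from the height by a continuous integer, hence by a constant.
  have hn01 : n 0 = n 1 := isPreconnected_univ.constant hcont.continuousOn trivial trivial
  have h0 : (Quot.mk (Glue G) (edgePt e 0)) = Quot.mk _ (vertexPt a) :=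
    Quot.sound (Glue.edge_start e)
  have h1 : (Quot.mk (Glue G) (edgePt e 1)) = Quot.mk _ (vertexPt b) := by
    rw [Quot.sound (Glue.edge_reverse e 1), unitInterval.symm_one,
      Quot.sound (Glue.edge_start e.symm)]
    rfl
  have e0 := hn 0
  have e1 := hn 1
  rw [h0, hh] at e0
  rw [h1, hh] at e1
  simp only [cellHeight, edgePt, e] at e0 e1
  rw [hn01] at e0
  have : ((h b - h a : ℤ) : ℝ) = (c a b : ℤ) := by
    simp only [Set.Icc.coe_zero, Set.Icc.coe_one, mul_zero, mul_one, sub_zero] at e0 e1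
    push_cast
    linarith
  exact_mod_cast this

end Topology

/-! ### Parallelism classes and their halfspaces -/

section Parallelism

variable {V : Type*} {G : SimpleGraph V}

theorem Opposite.symm {e f : Sym2 V} (h : Opposite G e f) : Opposite G f e := by
  obtain ⟨Q, rfl, rfl⟩ := h
  exact ⟨Q.rotate.rotate, rfl, rfl⟩

theorem Opposite.mem_edgeSet {e f : Sym2 V} (h : Opposite G e f) : f ∈ G.edgeSet := by
  obtain ⟨Q, -, rfl⟩ := h
  exact Q.adj_cd

theorem Opposite.parallel {e f : Sym2 V} (h : Opposite G e f) : Parallel G e f :=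
  ⟨h.symm.mem_edgeSet, h.mem_edgeSet, .single h⟩

theorem Parallel.refl {e : Sym2 V} (h : e ∈ G.edgeSet) : Parallel G e e := ⟨h, h, .refl⟩

theorem Parallel.symm {e f : Sym2 V} (h : Parallel G e f) : Parallel G f e := by
  refine ⟨h.2.1, h.1, ?_⟩
  induction h.2.2 with
  | refl => exact .refl
  | tail hp ho ih => exact .head ho.symm (ih ⟨h.1, ho.symm.mem_edgeSet, hp⟩)

theorem Parallel.trans {e f g : Sym2 V} (h : Parallel G e f) (h' : Parallel G f g) :
    Parallel G e g :=
  ⟨h.1, h'.2.1, h.2.2.trans h'.2.2⟩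

/-- The hyperplane of an edge. -/
def parallelClass (G : SimpleGraph V) (e : Sym2 V) : Set (Sym2 V) := {f | Parallel G e f}

theorem isHyperplane_parallelClass {e : Sym2 V} (h : e ∈ G.edgeSet) :
    IsHyperplane G (parallelClass G e) := ⟨e, h, rfl⟩

theorem mem_parallelClass_self {e : Sym2 V} (h : e ∈ G.edgeSet) : e ∈ parallelClass G e :=
  Parallel.refl h

theorem IsHyperplane.eq_parallelClass {J : Set (Sym2 V)} (hJ : IsHyperplane G J) {e : Sym2 V}
    (he : e ∈ J) : J = parallelClass G e := by
  obtain ⟨e₀, -, rfl⟩ := hJ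
  ext f
  exact ⟨fun hf => Parallel.trans (Parallel.symm he) hf, fun hf => Parallel.trans he hf⟩

theorem IsHyperplane.mem_iff_of_opposite {J : Set (Sym2 V)} (hJ : IsHyperplane G J) {e f : Sym2 V}
    (h : Opposite G e f) : e ∈ J ↔ f ∈ J := by
  obtain ⟨e₀, -, rfl⟩ := hJ
  exact ⟨fun he => Parallel.trans he h.parallel, fun hf => Parallel.trans hf h.parallel.symm⟩

theorem FourCycle.opposite (Q : FourCycle G) : Opposite G s(Q.a, Q.b) s(Q.d, Q.c) :=
  ⟨Q, rfl, Sym2.eq_swap⟩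

theorem FourCycle.opposite' (Q : FourCycle G) : Opposite G s(Q.a, Q.d) s(Q.b, Q.c) :=
  ⟨Q.reflect, rfl, Sym2.eq_swap⟩

theorem halfspaceAt_halfspaces (J : Set (Sym2 V)) (x : V) :
    halfspaceAt (halfspaces G J) x = {y | (G.deleteEdges J).Reachable x y} := by
  ext y
  constructor
  · rintro ⟨A, ⟨C, rfl⟩, hx, hy⟩
    exact SimpleGraph.ConnectedComponent.exact (hx.trans hy.symm)
  · intro h
    exact ⟨_, ⟨(G.deleteEdges J).connectedComponentMk x, rfl⟩, rfl,
      (SimpleGraph.ConnectedComponent.sound h).symm⟩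

theorem halfspaceAt_halfspaces_eq_iff {J : Set (Sym2 V)} {x y : V} :
    halfspaceAt (halfspaces G J) x = halfspaceAt (halfspaces G J) y ↔
      (G.deleteEdges J).Reachable x y := by
  rw [halfspaceAt_halfspaces, halfspaceAt_halfspaces]
  constructor
  · intro h
    have : y ∈ {z | (G.deleteEdges J).Reachable y z} := SimpleGraph.Reachable.refl _
    rwa [← h] at this
  · intro h
    ext z
    exact ⟨fun hz => h.symm.trans hz, fun hz => h.trans hz⟩

theorem mem_halfspaces_iff {J : Set (Sym2 V)} {A : Set V} :
    A ∈ halfspaces G J ↔ ∃ x, A = {y | (G.deleteEdges J).Reachable x y} := by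
  constructor
  · rintro ⟨C, rfl⟩
    obtain ⟨x, rfl⟩ := C.exists_rep
    refine ⟨x, ?_⟩
    ext y
    exact ⟨fun h => (SimpleGraph.ConnectedComponent.exact h).symm,
      fun h => SimpleGraph.ConnectedComponent.sound h.symm⟩
  · rintro ⟨x, rfl⟩
    refine ⟨(G.deleteEdges J).connectedComponentMk x, ?_⟩
    ext y
    exact ⟨fun h => SimpleGraph.ConnectedComponent.sound h.symm,
      fun h => (SimpleGraph.ConnectedComponent.exact h).symm⟩

end Parallelism

/-! ### Coordinates of a hypercube embedding -/

section Hypercube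

variable {V S : Type*} {G : SimpleGraph V}

theorem hypercube_adj_iff {A B : Finset S} :
    (hypercube S).Adj A B ↔ ∃ s, ∀ x, ¬(x ∈ A ↔ x ∈ B) ↔ x = s := by
  change (symmDiff (A : Set S) (B : Set S)).ncard = 1 ↔ _
  rw [Set.ncard_eq_one]
  refine exists_congr fun s => ?_
  rw [Set.ext_iff]
  refine forall_congr' fun x => ?_
  rw [Set.mem_symmDiff, Set.mem_singleton_iff, Finset.mem_coe, Finset.mem_coe]
  tauto

variable (f : G →g hypercube S)

open Classical in
/-- The `s`-th coordinate of a vertex. -/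
noncomputable def coordinate (s : S) (v : V) : ℤ := if s ∈ f v then 1 else 0

theorem coordinate_eq_iff {s : S} {v w : V} :
    coordinate f s v = coordinate f s w ↔ (s ∈ f v ↔ s ∈ f w) := by
  unfold coordinate
  split_ifs <;> simp_all

open Classical in
/-- The coboundary of the `s`-th coordinate, restricted to the edges in `J`. -/
noncomputable def coordinateCochain (s : S) (J : Set (Sym2 V)) (a b : V) : ℤ :=
  if s(a, b) ∈ J then coordinate f s b - coordinate f s a else 0

variable {f} (hf : Function.Injective f)
include hf

/-- Injectivity makes consecutive sides flip distinct coordinates; each coordinate is flipped an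
even number of times around the cycle, so opposite sides share theirs. -/
theorem FourCycle.mem_label (Q : FourCycle G) :
    ∃ s t, s ≠ t ∧ (∀ x, ¬(x ∈ f Q.a ↔ x ∈ f Q.b) ↔ x = s) ∧
      (∀ x, ¬(x ∈ f Q.d ↔ x ∈ f Q.c) ↔ x = s) ∧
      (∀ x, ¬(x ∈ f Q.a ↔ x ∈ f Q.d) ↔ x = t) ∧
      (∀ x, ¬(x ∈ f Q.b ↔ x ∈ f Q.c) ↔ x = t) := by
  obtain ⟨s, hs⟩ := hypercube_adj_iff.1 (f.map_adj Q.adj_ab)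
  obtain ⟨t, ht⟩ := hypercube_adj_iff.1 (f.map_adj Q.adj_bc)
  obtain ⟨u, hu⟩ := hypercube_adj_iff.1 (f.map_adj Q.adj_cd.symm)
  obtain ⟨v, hv⟩ := hypercube_adj_iff.1 (f.map_adj Q.adj_da.symm)
  have hst : s ≠ t := by
    rintro rfl
    refine Q.ne_ac (hf (Finset.ext fun x => ?_))
    have := hs x
    have := ht x
    tauto
  have hsv : s ≠ v := by
    rintro rfl
    refine Q.ne_bd (hf (Finset.ext fun x => ?_))
    have := hs x
    have := hv x
    tauto
  have hsu : s = u := by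
    refine (hu s).1 ?_
    have h1 := hs s
    have h2 := ht s
    have h3 := hv s
    tauto
  have htv : v = t := by
    refine (ht v).1 ?_
    have h1 := hs v
    have h2 := hu v
    have h3 := hv v
    have : v ≠ u := hsu ▸ hsv.symm
    have := hsv.symm
    tauto
  subst hsu htv
  exact ⟨s, v, hsv, hs, hu, hv, ht⟩

/-- The equality holds with signs: if `ab` flips `s`, then `ad` and `bc` do not, so the values of
`s` at `a`, `b` are those at `d`, `c`. -/
theorem FourCycle.coordinateCochain_eq (Q : FourCycle G) (s : S) {J : Set (Sym2 V)}
    (hJ : IsHyperplane G J) :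
    coordinateCochain f s J Q.a Q.b = coordinateCochain f s J Q.d Q.c := by
  classical
  unfold coordinateCochain
  rw [if_congr (hJ.mem_iff_of_opposite Q.opposite) rfl rfl]
  congr 1
  obtain ⟨u, t, hut, h1, h2, h3, h4⟩ := Q.mem_label hf
  have h1 := h1 s
  have h2 := h2 s
  have h3 := h3 s
  have h4 := h4 s
  unfold coordinate
  by_cases hu : s = u
  · have : s ≠ t := hu ▸ hut
    rw [if_congr (show s ∈ f Q.b ↔ s ∈ f Q.c by tauto) rfl rfl,
      if_congr (show s ∈ f Q.a ↔ s ∈ f Q.d by tauto) rfl rfl]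
  · rw [if_congr (show s ∈ f Q.b ↔ s ∈ f Q.a by tauto) rfl rfl,
      if_congr (show s ∈ f Q.c ↔ s ∈ f Q.d by tauto) rfl rfl, sub_self, sub_self]

/-- Parallel edges flip the same coordinate, consecutive sides of a 4-cycle do not: a hyperplane
never crosses itself. -/
theorem FourCycle.not_mem_hyperplane (Q : FourCycle G) {J : Set (Sym2 V)} (hJ : IsHyperplane G J)
    (h : s(Q.a, Q.b) ∈ J) : s(Q.a, Q.d) ∉ J := by
  intro h'
  have key : ∀ e, Relation.ReflTransGen (Opposite G) s(Q.a, Q.b) e →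
      ∀ a b c d x, e = s(a, b) → s(Q.a, Q.b) = s(c, d) →
        ((x ∈ f a ↔ x ∈ f b) ↔ (x ∈ f c ↔ x ∈ f d)) := by
    intro e he
    induction he with
    | refl =>
      intro a b c d x h1 h2
      rw [h1, Sym2.eq_iff] at h2
      rcases h2 with ⟨rfl, rfl⟩ | ⟨rfl, rfl⟩
      · rfl
      · exact Iff.comm
    | tail _ ho ih =>
      intro a b c d x h1 h2
      obtain ⟨R, rfl, rfl⟩ := ho
      have h3 := ih R.a R.b c d x rfl h2
      obtain ⟨u, t, -, h4, h5, -⟩ := R.mem_label hf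
      have h6 : (x ∈ f R.d ↔ x ∈ f R.c) ↔ (x ∈ f R.a ↔ x ∈ f R.b) := by
        rw [← not_iff_not, h4, h5]
      rw [Sym2.eq_iff] at h1
      rcases h1 with ⟨rfl, rfl⟩ | ⟨rfl, rfl⟩
      · rw [← h3, ← h6]
        exact Iff.comm
      · rw [← h3, ← h6]
  obtain ⟨s, t, hst, h1, -, h2, -⟩ := Q.mem_label hf
  rw [hJ.eq_parallelClass h] at h'
  have := key _ h'.2.2 Q.a Q.d Q.a Q.b s rfl rfl
  have h1 := h1 s
  have h2 := h2 s
  tauto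

variable [SimplyConnectedSpace (SquareCompletion G)]

theorem exists_coordinate_potential (s : S) {J : Set (Sym2 V)} (hJ : IsHyperplane G J) :
    ∃ h : V → ℤ, ∀ a b, G.Adj a b → h b - h a = coordinateCochain f s J a b := by
  refine exists_potential (fun a b => ?_) fun Q => Q.coordinateCochain_eq hf s hJ
  unfold coordinateCochain
  rw [Sym2.eq_swap]
  split_ifs <;> ring

end Hypercube

/-! ### Hyperplanes of a submedian graph separate -/

section Submedian

variable {V : Type*} {G : SimpleGraph V}

theorem eq_of_reachable_deleteEdges {J : Set (Sym2 V)} {h : V → ℤ}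
    (hh : ∀ a b, G.Adj a b → s(a, b) ∉ J → h a = h b) {x y : V}
    (hxy : (G.deleteEdges J).Reachable x y) : h x = h y := by
  rw [SimpleGraph.reachable_iff_reflTransGen] at hxy
  induction hxy with
  | refl => rfl
  | tail _ hab ih =>
    rw [SimpleGraph.deleteEdges_adj] at hab
    rw [ih, hh _ _ hab.1 hab.2]

/-- The endpoints of an edge of a hyperplane of a submedian graph lie in distinct halfspaces, and
these are the only two. -/
theorem IsSubmedian.not_reachable_and_reachable (hG : IsSubmedian G) {a b : V} (hab : G.Adj a b)
    {J : Set (Sym2 V)} (hJ : IsHyperplane G J) (hJab : s(a, b) ∈ J) :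
    ¬(G.deleteEdges J).Reachable a b ∧
      ∀ x, (G.deleteEdges J).Reachable a x ∨ (G.deleteEdges J).Reachable b x := by
  obtain ⟨hconn, ⟨S, f, hf⟩, hsc⟩ := hG
  constructor
  · intro hr
    -- For the coordinate flipped by `ab`, the potential is constant off `J` but changes along `ab`.
    obtain ⟨s, hs⟩ := hypercube_adj_iff.1 (f.map_adj hab)
    obtain ⟨h, hh⟩ := exists_coordinate_potential hf s hJ
    have h1 : h a = h b := by
      refine eq_of_reachable_deleteEdges (fun u v huv hJuv => ?_) hr
      have := hh u v huv
      rw [coordinateCochain, if_neg hJuv] at this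
      linarith
    have h2 := hh a b hab
    rw [coordinateCochain, if_pos hJab, h1, sub_self, eq_comm, sub_eq_zero,
      coordinate_eq_iff] at h2
    exact (hs s).2 rfl h2.symm
  -- When an edge of `J` slides across a square, its ends move along sides that are not in `J`,
  -- hence stay in the components of `a` and `b`.
  · have key : ∀ e, Relation.ReflTransGen (Opposite G) s(a, b) e → ∀ x y, e = s(x, y) →
        ((G.deleteEdges J).Reachable a x ∧ (G.deleteEdges J).Reachable b y) ∨
        ((G.deleteEdges J).Reachable a y ∧ (G.deleteEdges J).Reachable b x) := by
      intro e he
      induction he with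
      | refl =>
        intro x y h
        rw [Sym2.eq_iff] at h
        rcases h with ⟨rfl, rfl⟩ | ⟨rfl, rfl⟩
        · exact Or.inl ⟨.refl _, .refl _⟩
        · exact Or.inr ⟨.refl _, .refl _⟩
      | tail hp ho ih =>
        intro x y h
        obtain ⟨Q, rfl, rfl⟩ := ho
        have hQJ : s(Q.a, Q.b) ∈ J := by
          rw [hJ.eq_parallelClass hJab]
          exact ⟨hab, Q.adj_ab, hp⟩
        have hadJ := Q.not_mem_hyperplane hf hJ hQJ
        have hbcJ : s(Q.b, Q.c) ∉ J := fun h =>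
          hadJ ((hJ.mem_iff_of_opposite Q.opposite').2 h)
        have had : (G.deleteEdges J).Reachable Q.a Q.d :=
          SimpleGraph.Adj.reachable (SimpleGraph.deleteEdges_adj.2 ⟨Q.adj_da.symm, hadJ⟩)
        have hbc : (G.deleteEdges J).Reachable Q.b Q.c :=
          SimpleGraph.Adj.reachable (SimpleGraph.deleteEdges_adj.2 ⟨Q.adj_bc, hbcJ⟩)
        rw [Sym2.eq_iff] at h
        rcases h with ⟨rfl, rfl⟩ | ⟨rfl, rfl⟩ <;> rcases ih _ _ rfl with ⟨h1, h2⟩ | ⟨h1, h2⟩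
        · exact Or.inr ⟨h1.trans had, h2.trans hbc⟩
        · exact Or.inl ⟨h1.trans hbc, h2.trans had⟩
        · exact Or.inl ⟨h1.trans had, h2.trans hbc⟩
        · exact Or.inr ⟨h1.trans hbc, h2.trans had⟩
    intro x
    have hx := (SimpleGraph.reachable_iff_reflTransGen a x).1 (hconn.preconnected a x)
    induction hx with
    | refl => exact Or.inl (.refl _)
    | @tail y z _ hyz ih =>
      by_cases hJyz : s(y, z) ∈ J
      · rw [hJ.eq_parallelClass hJab] at hJyz
        rcases key _ hJyz.2.2 y z rfl with h | h
        · exact Or.inr h.2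
        · exact Or.inl h.1
      · have hr : (G.deleteEdges J).Reachable y z :=
          SimpleGraph.Adj.reachable (SimpleGraph.deleteEdges_adj.2 ⟨hyz, hJyz⟩)
        exact ih.imp (fun h => h.trans hr) fun h => h.trans hr

theorem IsSubmedian.reachable_iff (hG : IsSubmedian G) {a b : V} (hab : G.Adj a b)
    {J : Set (Sym2 V)} (hJ : IsHyperplane G J) :
    (G.deleteEdges J).Reachable a b ↔ s(a, b) ∉ J :=
  ⟨fun h hJab => (hG.not_reachable_and_reachable hab hJ hJab).1 h,
    fun h => SimpleGraph.Adj.reachable (SimpleGraph.deleteEdges_adj.2 ⟨hab, h⟩)⟩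

theorem reachable_deleteEdges_of_walk {J : Set (Sym2 V)} {x y : V} (p : G.Walk x y)
    (hp : ∀ e ∈ p.edges, e ∉ J) : (G.deleteEdges J).Reachable x y := by
  induction p with
  | nil => exact .refl _
  | cons h p ih =>
    simp only [SimpleGraph.Walk.edges_cons, List.mem_cons, forall_eq_or_imp] at hp
    exact (SimpleGraph.Adj.reachable (SimpleGraph.deleteEdges_adj.2 ⟨h, hp.1⟩)).trans (ih hp.2)

open Classical in
/-- Hyperplanes of a submedian graph separate its vertices. -/
theorem IsSubmedian.eq_of_forall_reachable (hG : IsSubmedian G) {x y : V}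
    (h : ∀ J, IsHyperplane G J → (G.deleteEdges J).Reachable x y) : x = y := by
  obtain ⟨hconn, ⟨S, f, hf⟩, hsc⟩ := hG
  refine hf (Finset.ext fun s => ?_)
  choose! φ hφ using fun (J : Set (Sym2 V)) (hJ : IsHyperplane G J) =>
    exists_coordinate_potential hf s hJ
  obtain ⟨p⟩ := hconn.preconnected x y
  -- An edge lies in a single hyperplane, so along it only one potential moves, by the increment of
  -- the coordinate.
  have key : ∀ (𝒥 : Finset (Set (Sym2 V))), (∀ J ∈ 𝒥, IsHyperplane G J) →
      ∀ (u v : V) (q : G.Walk u v), (∀ e ∈ q.edges, parallelClass G e ∈ 𝒥) →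
      ∑ J ∈ 𝒥, φ J u - coordinate f s u = ∑ J ∈ 𝒥, φ J v - coordinate f s v := by
    intro 𝒥 h𝒥 u v q hq
    induction q with
    | nil => rfl
    | @cons u w v huw q ih =>
      simp only [SimpleGraph.Walk.edges_cons, List.mem_cons, forall_eq_or_imp] at hq
      rw [← ih hq.2]
      have : ∑ J ∈ 𝒥, φ J w - ∑ J ∈ 𝒥, φ J u = coordinate f s w - coordinate f s u := by
        rw [← Finset.sum_sub_distrib, Finset.sum_eq_single_of_mem _ hq.1]
        · rw [hφ _ (h𝒥 _ hq.1) _ _ huw, coordinateCochain,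
            if_pos (mem_parallelClass_self huw)]
        · intro J hJ hne
          rw [hφ _ (h𝒥 _ hJ) _ _ huw, coordinateCochain, if_neg]
          exact fun hmem => hne ((h𝒥 _ hJ).eq_parallelClass hmem)
      linarith
  have h𝒥 : ∀ J ∈ (p.edges.map (parallelClass G)).toFinset, IsHyperplane G J := by
    intro J hJ
    simp only [List.mem_toFinset, List.mem_map] at hJ
    obtain ⟨e, he, rfl⟩ := hJ
    exact isHyperplane_parallelClass (p.edges_subset_edgeSet he)
  have h1 := key _ h𝒥 x y p fun e he => by
    rw [List.mem_toFinset]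
    exact List.mem_map_of_mem he
  have h2 : ∀ J ∈ (p.edges.map (parallelClass G)).toFinset, φ J x = φ J y := by
    intro J hJ
    refine eq_of_reachable_deleteEdges (fun u v huv hJuv => ?_) (h J (h𝒥 J hJ))
    have := hφ J (h𝒥 J hJ) u v huv
    rw [coordinateCochain, if_neg hJuv] at this
    linarith
  rw [Finset.sum_congr rfl h2] at h1
  rw [← coordinate_eq_iff]
  linarith

end Submedian

/-! ### Halfspaces and hyperplanes of median graphs -/

section Median

variable {V : Type*} {Y : SimpleGraph V}

theorem exists_adj_dist_add_one (hY : Y.Connected) {x y : V} (hxy : x ≠ y) :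
    ∃ v, Y.Adj x v ∧ Y.dist y v + 1 = Y.dist y x := by
  obtain ⟨p, hp⟩ := hY.exists_walk_length_eq_dist x y
  cases p with
  | nil => exact absurd rfl hxy
  | @cons _ v _ h p =>
    refine ⟨v, h, ?_⟩
    rw [SimpleGraph.Walk.length_cons] at hp
    have h1 := SimpleGraph.dist_le p
    have h2 := hY.dist_triangle (u := x) (v := v) (w := y)
    rw [SimpleGraph.dist_eq_one_iff_adj.2 h] at h2
    rw [SimpleGraph.dist_comm (u := y) (v := v), SimpleGraph.dist_comm (u := y) (v := x)]
    omega

/-- The vertices that are closer to `a` than to `b`. -/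
def nearer (Y : SimpleGraph V) (a b : V) : Set V := {w | Y.dist w a < Y.dist w b}

theorem mem_nearer {a b w : V} : w ∈ nearer Y a b ↔ Y.dist w a < Y.dist w b := Iff.rfl

theorem left_mem_nearer {a b : V} (h : Y.Adj a b) : a ∈ nearer Y a b := by
  rw [mem_nearer, SimpleGraph.dist_self, SimpleGraph.dist_eq_one_iff_adj.2 h]
  exact one_pos

theorem right_notMem_nearer {a b : V} : b ∉ nearer Y a b := by
  rw [mem_nearer, SimpleGraph.dist_self]
  exact Nat.not_lt_zero _

theorem exists_nearer_separating (hY : Y.Connected) {x y : V} (hxy : x ≠ y) :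
    ∃ u v, Y.Adj u v ∧ x ∈ nearer Y u v ∧ y ∉ nearer Y u v := by
  obtain ⟨v, h, hv⟩ := exists_adj_dist_add_one hY hxy
  refine ⟨x, v, h, left_mem_nearer h, ?_⟩
  rw [mem_nearer]
  omega

/-- The median of `w`, `a`, `b` lies between the adjacent vertices `a` and `b`, so it is one of
them. -/
theorem IsMedian.dist_eq_add_one_or (hY : IsMedian Y) {a b : V} (h : Y.Adj a b) (w : V) :
    Y.dist w b = Y.dist w a + 1 ∨ Y.dist w a = Y.dist w b + 1 := by
  obtain ⟨m, ⟨h1, h2, h3⟩, -⟩ := hY.2 w a b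
  rw [SimpleGraph.dist_eq_one_iff_adj.2 h] at h3
  have h4 := SimpleGraph.dist_comm (G := Y) (u := a) (v := m)
  rcases Nat.eq_zero_or_pos (Y.dist m b) with h0 | h0
  · have := (hY.1.preconnected m b).dist_eq_zero_iff.1 h0
    subst this
    omega
  · have h5 : Y.dist a m = 0 := by omega
    have := (hY.1.preconnected a m).dist_eq_zero_iff.1 h5
    subst this
    omega

theorem IsMedian.notMem_nearer_iff (hY : IsMedian Y) {a b : V} (h : Y.Adj a b) {w : V} :
    w ∉ nearer Y a b ↔ w ∈ nearer Y b a := by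
  rw [mem_nearer, mem_nearer]
  have := hY.dist_eq_add_one_or h w
  omega

theorem IsMedian.dist_eq_two (hY : IsMedian Y) {a b c : V} (hab : Y.Adj b a) (hbc : Y.Adj b c)
    (hac : a ≠ c) : Y.dist a c = 2 := by
  have h1 := hY.dist_eq_add_one_or hbc a
  rw [SimpleGraph.dist_eq_one_iff_adj.2 hab.symm] at h1
  have h2 : Y.dist a c ≠ 0 := fun h => hac ((hY.1.preconnected a c).dist_eq_zero_iff.1 h)
  omega

/-- The quadrangle condition. -/
theorem IsMedian.exists_square (hY : IsMedian Y) {p q r w : V} (hpq : Y.Adj p q)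
    (hpr : Y.Adj p r) (hqr : q ≠ r) (h1 : Y.dist w p = Y.dist w q + 1)
    (h2 : Y.dist w p = Y.dist w r + 1) :
    ∃ m, Y.Adj q m ∧ Y.Adj r m ∧ Y.dist w q = Y.dist w m + 1 := by
  obtain ⟨m, ⟨h3, h4, h5⟩, -⟩ := hY.2 w q r
  have h6 := hY.dist_eq_two hpq hpr hqr
  have h7 := SimpleGraph.dist_comm (G := Y) (u := q) (v := m)
  refine ⟨m, SimpleGraph.dist_eq_one_iff_adj.1 ?_, SimpleGraph.dist_eq_one_iff_adj.1 ?_, ?_⟩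
  · omega
  · rw [SimpleGraph.dist_comm]
    omega
  · omega

/-- Otherwise `a` and `c` are equally far from some `w`, and `b`, `d` one further. The quadrangle
condition gives a common neighbour `m` of `a` and `c` nearer to `w`; then `a` and `c` are both
medians of `b`, `d`, `m`. -/
theorem IsMedian.nearer_subset (hY : IsMedian Y) (Q : FourCycle Y) :
    nearer Y Q.a Q.b ⊆ nearer Y Q.d Q.c := by
  intro w hw
  by_contra hcon
  rw [mem_nearer] at hw hcon
  have h1 := hY.dist_eq_add_one_or Q.adj_ab w
  have h2 := hY.dist_eq_add_one_or Q.adj_bc w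
  have h3 := hY.dist_eq_add_one_or Q.adj_cd w
  have h4 := hY.dist_eq_add_one_or Q.adj_da w
  obtain ⟨m, ham, hcm, hm⟩ := hY.exists_square (w := w) Q.adj_ab.symm Q.adj_bc Q.ne_ac
    (by omega) (by omega)
  have hbm : Q.b ≠ m := by
    intro h
    rw [← h] at hm
    omega
  have hdm : Q.d ≠ m := by
    intro h
    rw [← h] at hm
    omega
  refine Q.ne_ac ((hY.2 Q.b Q.d m).unique (y₁ := Q.a) (y₂ := Q.c) ?_ ?_)
  · rw [hY.dist_eq_two Q.adj_ab Q.adj_da.symm Q.ne_bd, hY.dist_eq_two Q.adj_ab ham hbm,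
      hY.dist_eq_two Q.adj_da.symm ham hdm, SimpleGraph.dist_eq_one_iff_adj.2 Q.adj_ab.symm,
      SimpleGraph.dist_eq_one_iff_adj.2 Q.adj_da, SimpleGraph.dist_eq_one_iff_adj.2 Q.adj_da.symm,
      SimpleGraph.dist_eq_one_iff_adj.2 ham]
    exact ⟨rfl, rfl, rfl⟩
  · rw [hY.dist_eq_two Q.adj_ab Q.adj_da.symm Q.ne_bd, hY.dist_eq_two Q.adj_ab ham hbm,
      hY.dist_eq_two Q.adj_da.symm ham hdm, SimpleGraph.dist_eq_one_iff_adj.2 Q.adj_bc,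
      SimpleGraph.dist_eq_one_iff_adj.2 Q.adj_cd, SimpleGraph.dist_eq_one_iff_adj.2 Q.adj_cd.symm,
      SimpleGraph.dist_eq_one_iff_adj.2 hcm]
    exact ⟨rfl, rfl, rfl⟩

theorem IsMedian.nearer_eq (hY : IsMedian Y) (Q : FourCycle Y) :
    nearer Y Q.a Q.b = nearer Y Q.d Q.c :=
  (hY.nearer_subset Q).antisymm (hY.nearer_subset Q.rotate.rotate.rotate.reflect)

theorem IsMedian.nearer_eq_or_of_parallel (hY : IsMedian Y) {a b c d : V}
    (h : Parallel Y s(a, b) s(c, d)) :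
    nearer Y a b = nearer Y c d ∨ nearer Y a b = nearer Y d c := by
  obtain ⟨-, -, h⟩ := h
  generalize he : s(c, d) = e at h
  induction h generalizing c d with
  | refl =>
    rw [Sym2.eq_iff] at he
    rcases he with ⟨rfl, rfl⟩ | ⟨rfl, rfl⟩
    · exact Or.inl rfl
    · exact Or.inr rfl
  | tail _ ho ih =>
    obtain ⟨Q, rfl, rfl⟩ := ho
    rw [Sym2.eq_iff] at he
    have h1 := hY.nearer_eq Q
    have h2 : nearer Y Q.b Q.a = nearer Y Q.c Q.d := hY.nearer_eq Q.rotate.reflect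
    rcases he with ⟨rfl, rfl⟩ | ⟨rfl, rfl⟩
    · rw [← h1, ← h2]
      exact (ih rfl).symm
    · rw [← h1, ← h2]
      exact ih rfl

/-- Slide `cd` towards `ab`: for a neighbour `e` of `c` nearer to `a`, both `d` and `e` are nearer
to `b` than `c` is, and the quadrangle condition based at `b` yields the square. -/
theorem IsMedian.parallel_of_mem_nearer (hY : IsMedian Y) {a b c d : V} (hab : Y.Adj a b)
    (hcd : Y.Adj c d) (hc : c ∈ nearer Y a b) (hd : d ∉ nearer Y a b) :
    Parallel Y s(a, b) s(c, d) := by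
  induction hn : Y.dist c a generalizing c d with
  | zero =>
    have := (hY.1.preconnected c a).dist_eq_zero_iff.1 hn
    subst this
    rw [mem_nearer] at hc hd
    have h1 := hY.dist_eq_add_one_or hab d
    have h2 := SimpleGraph.dist_eq_one_iff_adj.2 hcd.symm
    have h3 : Y.dist d b = 0 := by omega
    have := (hY.1.preconnected d b).dist_eq_zero_iff.1 h3
    subst this
    exact Parallel.refl hcd
  | succ n ih =>
    rw [mem_nearer] at hc hd
    have h1 := hY.dist_eq_add_one_or hab c
    have h2 := hY.dist_eq_add_one_or hab d
    have h3 := hY.dist_eq_add_one_or hcd a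
    have h4 := hY.dist_eq_add_one_or hcd b
    simp only [SimpleGraph.dist_comm (G := Y) (u := a), SimpleGraph.dist_comm (G := Y) (u := b)]
      at h3 h4
    have hca : c ≠ a := by
      rintro rfl
      simp at hn
    obtain ⟨e, hce, he⟩ := exists_adj_dist_add_one hY.1 hca
    rw [SimpleGraph.dist_comm (u := a) (v := e), SimpleGraph.dist_comm (u := a) (v := c)] at he
    have hde : d ≠ e := by
      rintro rfl
      omega
    have h5 := hY.dist_eq_add_one_or hce b
    have h6 := hY.dist_eq_add_one_or hab e
    simp only [SimpleGraph.dist_comm (G := Y) (u := b)] at h5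
    obtain ⟨m, hdm, hem, hm⟩ := hY.exists_square (w := b) hcd hce hde
      (by simp only [SimpleGraph.dist_comm (G := Y) (u := b)]; omega)
      (by simp only [SimpleGraph.dist_comm (G := Y) (u := b)]; omega)
    simp only [SimpleGraph.dist_comm (G := Y) (u := b)] at hm
    have h7 := hY.dist_eq_add_one_or hab m
    have h8 := hY.dist_eq_add_one_or hdm a
    simp only [SimpleGraph.dist_comm (G := Y) (u := a)] at h8
    have hmc : m ≠ c := by
      rintro rfl
      omega
    refine (ih hem ?_ ?_ (by omega)).trans ?_
    · rw [mem_nearer]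
      omega
    · rw [mem_nearer]
      omega
    · exact Opposite.parallel
        (FourCycle.opposite ⟨e, m, d, c, hem, hdm.symm, hcd.symm, hce, hde.symm, hmc⟩)

theorem IsMedian.nearer_eq_of_mem (hY : IsMedian Y) {a b c d : V} (hab : Y.Adj a b)
    (hcd : Y.Adj c d) (hc : c ∈ nearer Y a b) (hd : d ∉ nearer Y a b) :
    nearer Y a b = nearer Y c d := by
  rcases hY.nearer_eq_or_of_parallel (hY.parallel_of_mem_nearer hab hcd hc hd) with h | h
  · exact h
  · rw [h] at hc
    exact absurd hc right_notMem_nearer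

/-- An edge of a median graph crosses the halfspaces of its parallelism class, and no others. -/
theorem IsMedian.parallel_iff (hY : IsMedian Y) {a b c d : V} (hab : Y.Adj a b)
    (hcd : Y.Adj c d) :
    Parallel Y s(a, b) s(c, d) ↔ ¬(c ∈ nearer Y a b ↔ d ∈ nearer Y a b) := by
  constructor
  · intro h
    rcases hY.nearer_eq_or_of_parallel h with h | h <;> rw [h]
    · exact fun h' => right_notMem_nearer (h'.1 (left_mem_nearer hcd))
    · exact fun h' => right_notMem_nearer (h'.2 (left_mem_nearer hcd.symm))
  · intro h
    by_cases hc : c ∈ nearer Y a b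
    · exact hY.parallel_of_mem_nearer hab hcd hc fun hd => h ⟨fun _ => hd, fun _ => hc⟩
    · have hd : d ∈ nearer Y a b := by
        by_contra hd
        exact h ⟨fun h => absurd h hc, fun h => absurd h hd⟩
      rw [Sym2.eq_swap (a := c)]
      exact hY.parallel_of_mem_nearer hab hcd.symm hd hc

theorem IsMedian.eq_of_parallel (hY : IsMedian Y) {a b c : V} (hab : Y.Adj a b)
    (h : Parallel Y s(a, b) s(a, c)) : b = c := by
  have hac : Y.Adj a c := h.2.1
  have hc : c ∉ nearer Y a b := fun hc =>
    (hY.parallel_iff hab hac).1 h ⟨fun _ => hc, fun _ => left_mem_nearer hab⟩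
  rw [mem_nearer, SimpleGraph.dist_eq_one_iff_adj.2 hac.symm] at hc
  have h1 := hY.dist_eq_add_one_or hab c
  rw [SimpleGraph.dist_eq_one_iff_adj.2 hac.symm] at h1
  exact ((hY.1.preconnected c b).dist_eq_zero_iff.1 (by omega)).symm

/-- If every halfspace that contains `y` but not `a` meets the side of `b` of the hyperplane of
`ab`, then this hyperplane is crossed by an edge at `y`. -/
theorem IsMedian.exists_adj_notMem_nearer (hY : IsMedian Y) {a b y : V} (hab : Y.Adj a b)
    (hy : y ∈ nearer Y a b)
    (h : ∀ u v, Y.Adj u v → y ∈ nearer Y u v → a ∉ nearer Y u v →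
      ∃ w ∈ nearer Y u v, w ∉ nearer Y a b) :
    ∃ z, Y.Adj y z ∧ z ∉ nearer Y a b := by
  induction hn : Y.dist a y generalizing y with
  | zero =>
    have := (hY.1.preconnected a y).dist_eq_zero_iff.1 hn
    subst this
    exact ⟨b, hab, right_notMem_nearer⟩
  | succ n ih =>
    have hya : y ≠ a := by
      rintro rfl
      simp at hn
    obtain ⟨x, hyx, hx⟩ := exists_adj_dist_add_one hY.1 hya
    have hay : a ∉ nearer Y y x := by
      rw [mem_nearer]
      omega
    obtain ⟨w, hw, hwab⟩ := h y x hyx (left_mem_nearer hyx) hay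
    have hxab : x ∈ nearer Y a b := by
      rw [mem_nearer] at hy ⊢
      have h1 := hY.dist_eq_add_one_or hyx b
      simp only [SimpleGraph.dist_comm (G := Y) (u := a), SimpleGraph.dist_comm (G := Y) (u := b)]
        at *
      omega
    -- The hypothesis passes from `y` to `x`: a halfspace containing `x` but not `y` is `nearer Y x
    -- y`, which contains `a`.
    obtain ⟨z, hxz, hz⟩ := ih hxab (fun u v huv hxu hau => by
      refine h u v huv ?_ hau
      by_contra hyu
      have := hY.nearer_eq_of_mem huv hyx.symm hxu hyu
      rw [this, hY.notMem_nearer_iff hyx.symm] at hau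
      exact hay hau) (by omega)
    have h1 : nearer Y a b = nearer Y x z := hY.nearer_eq_of_mem hab hxz hxab hz
    rw [h1, mem_nearer] at hwab
    rw [mem_nearer] at hw
    have h2 := hY.dist_eq_add_one_or hxz w
    have h3 := hY.dist_eq_add_one_or hyx w
    have hyz : y ≠ z := by
      rintro rfl
      exact hz hy
    -- From `x`, both `y` and `z` are steps towards `w`; they span a square that carries `xz` to an
    -- edge at `y`.
    obtain ⟨m, hym, hzm, hm⟩ := hY.exists_square (w := w) hyx.symm hxz hyz (by omega) (by omega)
    have hmx : m ≠ x := by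
      rintro rfl
      omega
    refine ⟨m, hym, ?_⟩
    rw [h1, hY.nearer_eq ⟨x, z, m, y, hxz, hzm, hym.symm, hyx, hmx.symm, hyz.symm⟩]
    exact right_notMem_nearer

end Median

/-! ### Flips, connectedness and parallelism in cubulations -/

section Cubulation

variable {P : Type*} {ω : Wallspace P}

namespace Wallspace

theorem eq_compl_of_ne (W : ω.walls) {A B : Set P} (hA : A ∈ W.1) (hB : B ∈ W.1) (h : A ≠ B) :
    B = Aᶜ := by
  obtain ⟨C, D, hW, -, -, hCD, hd⟩ := ω.partition W W.2
  rw [hW] at hA hB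
  have hc : IsCompl C D :=
    ⟨Set.disjoint_iff_inter_eq_empty.2 hd, codisjoint_iff.2 hCD⟩
  rcases hA with rfl | rfl <;> rcases hB with rfl | rfl
  · exact absurd rfl h
  · exact hc.compl_eq.symm
  · exact hc.symm.compl_eq.symm
  · exact absurd rfl h

theorem compl_mem (W : ω.walls) {A : Set P} (hA : A ∈ W.1) : Aᶜ ∈ W.1 := by
  obtain ⟨C, D, hW, hC, hD, hCD, hd⟩ := ω.partition W W.2
  have hne : C ≠ D := by
    rintro rfl
    rw [Set.inter_self] at hd
    exact hC.ne_empty hd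
  have hCW : C ∈ W.1 := by rw [hW]; exact Or.inl rfl
  have hDW : D ∈ W.1 := by rw [hW]; exact Or.inr rfl
  by_cases h : A = C
  · rw [h, ← eq_compl_of_ne W hCW hDW hne]
    exact hDW
  · rw [← eq_compl_of_ne W hA hCW h]
    exact hCW

theorem wall_ext {U W : ω.walls} {A : Set P} (hU : A ∈ U.1) (hW : A ∈ W.1) : U = W := by
  have key : ∀ (U W : ω.walls), A ∈ U.1 → A ∈ W.1 → U.1 ⊆ W.1 := by
    intro U W hU hW B hB
    by_cases h : A = B
    · exact h ▸ hW
    · rw [eq_compl_of_ne U hU hB h]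
      exact compl_mem W hW
  exact Subtype.ext ((key U W hU hW).antisymm (key W U hW hU))

theorem eq_of_ne_of_ne (W : ω.walls) {A B C : Set P} (hA : A ∈ W.1) (hB : B ∈ W.1) (hC : C ∈ W.1)
    (h : A ≠ B) (h' : A ≠ C) : B = C := by
  rw [eq_compl_of_ne W hA hB h, eq_compl_of_ne W hA hC h']

theorem halfspaceAt_eq_of_mem (W : ω.walls) {A : Set P} (hA : A ∈ W.1) {x : P} (hx : x ∈ A) :
    halfspaceAt W.1 x = A := by
  by_contra h
  have := eq_compl_of_ne W (halfspaceAt_mem ω W x).1 hA h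
  rw [this] at hx
  exact hx (halfspaceAt_mem ω W x).2

theorem finite_halfspaceAt_ne (ω : Wallspace P) (x y : P) :
    {W : ω.walls | halfspaceAt W.1 x ≠ halfspaceAt W.1 y}.Finite := by
  refine Set.Finite.of_finite_image ((ω.finite_separating x y).subset ?_)
    Subtype.val_injective.injOn
  rintro _ ⟨W, hW, rfl⟩
  refine ⟨W.2, halfspaceAt W.1 x, halfspaceAt W.1 y, ?_, (halfspaceAt_mem ω W x).2,
    (halfspaceAt_mem ω W y).2⟩
  ext A
  constructor
  · intro hA
    by_cases h : halfspaceAt W.1 x = A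
    · exact Or.inl h.symm
    · exact Or.inr (eq_of_ne_of_ne W (halfspaceAt_mem ω W x).1 hA (halfspaceAt_mem ω W y).1 h hW)
  · rintro (rfl | rfl)
    · exact (halfspaceAt_mem ω W x).1
    · exact (halfspaceAt_mem ω W y).1

end Wallspace

open Wallspace

namespace CubulationVertex

/-- The halfspace of the wall `W` chosen by the orientation `μ`. -/
def side (μ : CubulationVertex ω) (W : ω.walls) : Set P := μ.1.toFun W

theorem side_mem (μ : CubulationVertex ω) (W : ω.walls) : μ.side W ∈ W.1 := μ.1.mem W

theorem ext_side {μ ν : CubulationVertex ω} (h : ∀ W, μ.side W = ν.side W) : μ = ν :=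
  Subtype.ext (Orientation.ext (funext h))

theorem side_canonicalMap (x : P) (W : ω.walls) :
    (canonicalMap ω x).side W = halfspaceAt W.1 x := rfl

theorem finite_side_ne (μ ν : CubulationVertex ω) : {W | μ.side W ≠ ν.side W}.Finite := by
  obtain ⟨x, hx⟩ := μ.2
  obtain ⟨y, hy⟩ := ν.2
  refine ((hx.union hy).union (finite_halfspaceAt_ne ω x y)).subset fun W hW => ?_
  by_contra h
  simp only [Set.mem_union, Set.mem_ofPred_eq, not_or, not_not] at h
  exact hW (h.1.1.trans (Eq.trans h.2 h.1.2.symm))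

/-- The orientations `μ` and `ν` differ on the wall `W`, and only there. -/
def DifferAt (W : ω.walls) (μ ν : CubulationVertex ω) : Prop :=
  μ.side W ≠ ν.side W ∧ ∀ U, U ≠ W → μ.side U = ν.side U

theorem DifferAt.symm {W : ω.walls} {μ ν : CubulationVertex ω} (h : DifferAt W μ ν) :
    DifferAt W ν μ :=
  ⟨h.1.symm, fun U hU => (h.2 U hU).symm⟩

theorem adj_iff_exists_differAt {μ ν : CubulationVertex ω} :
    (cubulation ω).Adj μ ν ↔ ∃ W, DifferAt W μ ν := by
  refine exists_congr fun W => and_congr_right fun _ => forall_congr' fun U => ?_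
  rw [← not_imp_not, not_not]
  rfl

theorem DifferAt.adj {W : ω.walls} {μ ν : CubulationVertex ω} (h : DifferAt W μ ν) :
    (cubulation ω).Adj μ ν :=
  adj_iff_exists_differAt.2 ⟨W, h⟩

theorem DifferAt.eq_of_differAt {W : ω.walls} {μ ν ν' : CubulationVertex ω} (h : DifferAt W μ ν)
    (h' : DifferAt W μ ν') : ν = ν' := by
  refine ext_side fun U => ?_
  by_cases hU : U = W
  · subst hU
    exact eq_of_ne_of_ne U (μ.side_mem U) (ν.side_mem U) (ν'.side_mem U) h.1 h'.1
  · rw [← h.2 U hU, h'.2 U hU]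

theorem DifferAt.wall_eq {U W : ω.walls} {μ ν : CubulationVertex ω} (h : DifferAt W μ ν)
    (hU : μ.side U ≠ ν.side U) : U = W := by
  by_contra hne
  exact hU (h.2 U hne)

/-- Around a 4-cycle the wall `W` has to be flipped back, and not on a side next to the first one,
since a vertex has only one neighbour across `W`. -/
theorem differAt_of_opposite {W : ω.walls} {μ μ' ν ν' : CubulationVertex ω}
    (h : Opposite (cubulation ω) s(μ, μ') s(ν, ν')) (hW : DifferAt W μ μ') :
    DifferAt W ν ν' := by
  have key : ∀ Q : FourCycle (cubulation ω), DifferAt W Q.a Q.b → DifferAt W Q.c Q.d := by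
    intro Q hQ
    obtain ⟨K, hK⟩ := adj_iff_exists_differAt.1 Q.adj_bc
    obtain ⟨L, hL⟩ := adj_iff_exists_differAt.1 Q.adj_cd
    obtain ⟨N, hN⟩ := adj_iff_exists_differAt.1 Q.adj_da
    have hKW : W ≠ K := by
      rintro rfl
      exact Q.ne_ac (hQ.symm.eq_of_differAt hK)
    have hNW : W ≠ N := by
      rintro rfl
      exact Q.ne_bd (hQ.eq_of_differAt hN.symm)
    have hLW : W = L := by
      refine hL.wall_eq fun h => hQ.1 ?_
      rw [hK.2 W hKW, h, hN.2 W hNW]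
    rwa [hLW]
  obtain ⟨Q, h1, h2⟩ := h
  have h3 : DifferAt W Q.a Q.b := by
    rw [Sym2.eq_iff] at h1
    rcases h1 with ⟨rfl, rfl⟩ | ⟨rfl, rfl⟩
    · exact hW
    · exact hW.symm
  have h4 := key Q h3
  rw [Sym2.eq_iff] at h2
  rcases h2 with ⟨rfl, rfl⟩ | ⟨rfl, rfl⟩
  · exact h4
  · exact h4.symm

theorem differAt_of_parallel {W : ω.walls} {μ μ' ν ν' : CubulationVertex ω}
    (h : Parallel (cubulation ω) s(μ, μ') s(ν, ν')) (hW : DifferAt W μ μ') :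
    DifferAt W ν ν' := by
  obtain ⟨-, -, h⟩ := h
  generalize he : s(ν, ν') = e at h
  induction h generalizing ν ν' with
  | refl =>
    rw [Sym2.eq_iff] at he
    rcases he with ⟨rfl, rfl⟩ | ⟨rfl, rfl⟩
    · exact hW
    · exact hW.symm
  | @tail f g _ ho ih =>
    subst he
    induction f with
    | _ a b => exact differAt_of_opposite ho (ih rfl)

open Classical in
/-- An orientation may be flipped on a wall on which it differs from another one, provided that
its halfspace is minimal for this property. -/
theorem exists_flip {μ ν : CubulationVertex ω} {W : ω.walls} (hW : μ.side W ≠ ν.side W)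
    (hmin : ∀ U, μ.side U ≠ ν.side U → μ.side U ⊆ μ.side W → U = W) :
    ∃ μ₁ : CubulationVertex ω, DifferAt W μ μ₁ := by
  have hνW : ν.side W = (μ.side W)ᶜ := eq_compl_of_ne W (μ.side_mem W) (ν.side_mem W) hW
  -- Where μ and ν agree, ν provides the intersection; elsewhere, disjointness would put `μ.side U`
  -- inside `μ.side W`, against minimality.
  have hinter : ∀ U, U ≠ W → (ν.side W ∩ μ.side U).Nonempty := by
    intro U hU
    by_cases h : μ.side U = ν.side U
    · rw [h]
      exact ν.1.inter W U
    · by_contra hcon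
      refine hU (hmin U h fun y hy => ?_)
      by_contra hyW
      exact hcon ⟨y, by rw [hνW]; exact hyW, hy⟩
  let τ : Orientation ω :=
    { toFun := fun U => if U = W then ν.side W else μ.side U
      mem := fun U => by
        split_ifs with h
        · exact h ▸ ν.side_mem W
        · exact μ.side_mem U
      inter := fun U U' => by
        split_ifs with h h' h'
        · exact ν.1.inter W W
        · exact hinter U' h'
        · rw [Set.inter_comm]
          exact hinter U h
        · exact μ.1.inter U U' }
  obtain ⟨x, hx⟩ := μ.2
  refine ⟨⟨τ, x, (hx.union (Set.finite_singleton W)).subset fun U hU => ?_⟩, ?_, fun U hU => ?_⟩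
  · by_cases h : U = W
    · exact Or.inr h
    · refine Or.inl ?_
      have hτ : τ.toFun U = μ.side U := if_neg h
      rw [Set.mem_ofPred_eq, hτ] at hU
      exact hU
  · have hτ : τ.toFun W = ν.side W := if_pos rfl
    change μ.side W ≠ τ.toFun W
    rwa [hτ]
  · exact (if_neg hU).symm

theorem exists_minimal_side {μ ν : CubulationVertex ω} (h : μ ≠ ν) :
    ∃ W, μ.side W ≠ ν.side W ∧ ∀ U, μ.side U ≠ ν.side U → μ.side U ⊆ μ.side W → U = W := by
  have hne : {W | μ.side W ≠ ν.side W}.Nonempty := by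
    by_contra hcon
    refine h (ext_side fun W => ?_)
    by_contra hW
    exact hcon ⟨W, hW⟩
  obtain ⟨W, hW⟩ := (finite_side_ne μ ν).exists_minimalFor μ.side _ hne
  refine ⟨W, hW.1, fun U hU hUW => ?_⟩
  have := hUW.antisymm (hW.2 hU hUW)
  exact wall_ext (μ.side_mem U) (this ▸ μ.side_mem W)

theorem ncard_side_ne_lt {W : ω.walls} {μ μ₁ ν : CubulationVertex ω} (h : DifferAt W μ μ₁)
    (hW : μ.side W ≠ ν.side W) :
    {U | μ₁.side U ≠ ν.side U}.ncard < {U | μ.side U ≠ ν.side U}.ncard := by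
  have h1 : μ₁.side W = ν.side W :=
    eq_of_ne_of_ne W (μ.side_mem W) (μ₁.side_mem W) (ν.side_mem W) h.1 hW
  refine Set.ncard_lt_ncard ⟨fun U hU => ?_, fun hsub => hsub hW h1⟩ (finite_side_ne μ ν)
  have hne : U ≠ W := by
    rintro rfl
    exact hU h1
  rw [Set.mem_ofPred_eq, h.2 U hne]
  exact hU

theorem cubulation_preconnected (ω : Wallspace P) : (cubulation ω).Preconnected := by
  intro μ ν
  induction hn : {U | μ.side U ≠ ν.side U}.ncard using Nat.strong_induction_on generalizing μ with
  | _ n ih =>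
    by_cases h : μ = ν
    · rw [h]
    · obtain ⟨W, hW, hmin⟩ := exists_minimal_side h
      obtain ⟨μ₁, h₁⟩ := exists_flip hW hmin
      exact h₁.adj.reachable.trans (ih _ (hn ▸ ncard_side_ne_lt h₁ hW) μ₁ rfl)

/-- Flipping at both μ and μ' a minimal wall on which μ and ν disagree produces a square, and the
edge moves closer to νν'. -/
theorem parallel_of_side_eq {W : ω.walls} {μ μ' ν ν' : CubulationVertex ω} (h : DifferAt W μ μ')
    (h' : DifferAt W ν ν') (hW : μ.side W = ν.side W) :
    Parallel (cubulation ω) s(μ, μ') s(ν, ν') := by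
  induction hn : {U | μ.side U ≠ ν.side U}.ncard using Nat.strong_induction_on
    generalizing μ μ' with
  | _ n ih =>
    by_cases hμν : μ = ν
    · subst hμν
      rw [h.eq_of_differAt h']
      exact Parallel.refl h'.adj
    · have hW' : μ'.side W = ν'.side W :=
        eq_of_ne_of_ne W (μ.side_mem W) (μ'.side_mem W) (ν'.side_mem W) h.1 (hW ▸ h'.1)
      have hiff : ∀ U, U ≠ W → (μ.side U = μ'.side U ∧ ν.side U = ν'.side U) := fun U hU =>
        ⟨h.2 U hU, h'.2 U hU⟩
      obtain ⟨U, hU, hmin⟩ := exists_minimal_side hμν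
      have hUW : U ≠ W := by
        rintro rfl
        exact hU hW
      obtain ⟨μ₁, h₁⟩ := exists_flip hU hmin
      have hU' : μ'.side U ≠ ν'.side U := by
        rw [← (hiff U hUW).1, ← (hiff U hUW).2]
        exact hU
      -- Minimality persists at μ': passing to μ' and ν' changes only `W`, where these two still
      -- agree.
      obtain ⟨μ₁', h₁'⟩ := exists_flip hU' fun Z hZ hZU => by
        have hZW : Z ≠ W := by
          rintro rfl
          exact hZ hW'
        rw [← (hiff Z hZW).1, ← (hiff Z hZW).2] at hZ
        rw [← (hiff Z hZW).1, ← (hiff U hUW).1] at hZU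
        exact hmin Z hZ hZU
      have h₁W : DifferAt W μ₁ μ₁' := by
        refine ⟨?_, fun Z hZ => ?_⟩
        · rw [← h₁.2 W hUW.symm, ← h₁'.2 W hUW.symm]
          exact h.1
        · by_cases hZU : Z = U
          · subst hZU
            refine eq_of_ne_of_ne Z (μ.side_mem Z) (μ₁.side_mem Z) (μ₁'.side_mem Z) h₁.1 ?_
            rw [h.2 Z hZ]
            exact h₁'.1
          · rw [← h₁.2 Z hZU, ← h₁'.2 Z hZU, h.2 Z hZ]
      have hac : μ ≠ μ₁' := by
        rintro rfl
        exact h.1 (h₁'.2 W hUW.symm).symm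
      have hbd : μ' ≠ μ₁ := by
        rintro rfl
        exact h.1 (h₁.2 W hUW.symm)
      have hpar : Parallel (cubulation ω) s(μ, μ') s(μ₁, μ₁') := Opposite.parallel
        (FourCycle.opposite ⟨μ, μ', μ₁', μ₁, h.adj, h₁'.adj, h₁W.adj.symm, h₁.adj.symm, hac, hbd⟩)
      exact hpar.trans (ih _ (hn ▸ ncard_side_ne_lt h₁ hU) h₁W
        ((h₁.2 W hUW.symm).symm.trans hW) rfl)

/-- In a cubulation, the edges that correspond to the same wall are parallel. -/
theorem parallel_of_differAt {W : ω.walls} {μ μ' ν ν' : CubulationVertex ω} (h : DifferAt W μ μ')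
    (h' : DifferAt W ν ν') : Parallel (cubulation ω) s(μ, μ') s(ν, ν') := by
  by_cases hW : μ.side W = ν.side W
  · exact parallel_of_side_eq h h' hW
  · rw [Sym2.eq_swap (a := ν)]
    refine parallel_of_side_eq h h'.symm ?_
    exact eq_of_ne_of_ne W (ν.side_mem W) (μ.side_mem W) (ν'.side_mem W) (Ne.symm hW) h'.1

end CubulationVertex

end Cubulation

/-! ### The wallspace of a submedian graph and its canonical map -/

section HyperplaneWallspace

variable {V : Type*} {G : SimpleGraph V}

theorem IsSubmedian.exists_halfspaces_eq (hG : IsSubmedian G) {J : Set (Sym2 V)}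
    (hJ : IsHyperplane G J) {a b : V} (hab : G.Adj a b) (hJab : s(a, b) ∈ J) :
    halfspaces G J = {{x | (G.deleteEdges J).Reachable a x}, {x | (G.deleteEdges J).Reachable b x}}
    := by
  ext A
  rw [mem_halfspaces_iff]
  constructor
  · rintro ⟨x, rfl⟩
    rcases (hG.not_reachable_and_reachable hab hJ hJab).2 x with h | h
    · exact Or.inl (Set.ext fun y => ⟨fun hy => h.trans hy, fun hy => h.symm.trans hy⟩)
    · exact Or.inr (Set.ext fun y => ⟨fun hy => h.trans hy, fun hy => h.symm.trans hy⟩)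
  · rintro (rfl | rfl)
    · exact ⟨a, rfl⟩
    · exact ⟨b, rfl⟩

/-- The wallspace structure on a submedian graph given by its hyperplanes. -/
def IsSubmedian.wallspace (hG : IsSubmedian G) : Wallspace V where
  walls := hyperplaneWalls G
  partition := by
    rintro _ ⟨J, hJ, rfl⟩
    obtain ⟨e, he, rfl⟩ := id hJ
    induction e with
    | _ a b =>
      have hab : G.Adj a b := he
      have hJab := mem_parallelClass_self he
      obtain ⟨h1, h2⟩ := hG.not_reachable_and_reachable hab hJ hJab
      refine ⟨_, _, hG.exists_halfspaces_eq hJ hab hJab, ⟨a, .refl _⟩, ⟨b, .refl _⟩,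
        Set.eq_univ_of_forall h2, ?_⟩
      exact Set.eq_empty_of_forall_notMem fun x hx => h1 (hx.1.trans hx.2.symm)
  finite_separating := fun x y => by
    obtain ⟨p⟩ := hG.1.preconnected x y
    refine ((List.finite_toSet p.edges).image fun e => halfspaces G (parallelClass G e)).subset ?_
    rintro _ ⟨⟨J, hJ, rfl⟩, A, B, hAB, hx, hy⟩
    have hA : A ∈ halfspaces G J := by rw [hAB]; exact Or.inl rfl
    have hB : B ∈ halfspaces G J := by rw [hAB]; exact Or.inr rfl
    -- `Separates` allows `A = B`. A path avoiding `J` would force this, leaving a single component,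
    -- which is impossible.
    by_cases hp : ∀ e ∈ p.edges, e ∉ J
    · exfalso
      have hr := reachable_deleteEdges_of_walk p hp
      obtain ⟨e, he, rfl⟩ := id hJ
      induction e with
      | _ a b =>
        have h1 := (hG.not_reachable_and_reachable he hJ (mem_parallelClass_self he)).1
        obtain ⟨u, rfl⟩ := mem_halfspaces_iff.1 hA
        obtain ⟨v, rfl⟩ := mem_halfspaces_iff.1 hB
        have huv := hx.trans (hr.trans (SimpleGraph.Reachable.symm hy))
        have hall : ∀ w, (G.deleteEdges {f | Parallel G s(a, b) f}).Reachable u w := by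
          intro w
          have hw : {z | (G.deleteEdges {f | Parallel G s(a, b) f}).Reachable w z} ∈
              halfspaces G {f | Parallel G s(a, b) f} := mem_halfspaces_iff.2 ⟨w, rfl⟩
          rw [hAB] at hw
          have hww : w ∈ {z | (G.deleteEdges {f | Parallel G s(a, b) f}).Reachable w z} := .refl _
          rcases hw with hw | hw
          · rw [hw] at hww
            exact hww
          · rw [hw] at hww
            exact huv.trans hww
        exact h1 ((hall a).symm.trans (hall b))
    · push Not at hp
      obtain ⟨e, he, heJ⟩ := hp
      exact ⟨e, he, by rw [hJ.eq_parallelClass heJ]⟩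

theorem IsSubmedian.mem_walls_wallspace (hG : IsSubmedian G) {W : Set (Set V)} :
    W ∈ hG.wallspace.walls ↔ ∃ J, IsHyperplane G J ∧ W = halfspaces G J := Iff.rfl

/-- The edge `ab` crosses the wall `W`. -/
def Crosses (G : SimpleGraph V) {ω : Wallspace V} (W : ω.walls) (a b : V) : Prop :=
  G.Adj a b ∧ halfspaceAt W.1 a ≠ halfspaceAt W.1 b

theorem Crosses.symm {ω : Wallspace V} {W : ω.walls} {a b : V} (h : Crosses G W a b) :
    Crosses G W b a :=
  ⟨h.1.symm, h.2.symm⟩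

namespace IsSubmedian

variable (hG : IsSubmedian G)
include hG

theorem exists_hyperplane (W : hG.wallspace.walls) :
    ∃ J, IsHyperplane G J ∧ W.1 = halfspaces G J ∧ ∀ a b, Crosses G W a b ↔ s(a, b) ∈ J := by
  obtain ⟨J, hJ, hW⟩ := hG.mem_walls_wallspace.1 W.2
  refine ⟨J, hJ, hW, fun a b => ?_⟩
  have hsub : s(a, b) ∈ J → G.Adj a b := by
    obtain ⟨e, -, rfl⟩ := hJ
    exact fun h => h.2.1
  unfold Crosses
  rw [hW, ne_eq, halfspaceAt_halfspaces_eq_iff]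
  constructor
  · rintro ⟨hab, h⟩
    by_contra hcon
    exact h ((hG.reachable_iff hab hJ).2 hcon)
  · exact fun h => ⟨hsub h, fun hr => (hG.reachable_iff (hsub h) hJ).1 hr h⟩

theorem exists_crosses (W : hG.wallspace.walls) : ∃ a b, Crosses G W a b := by
  obtain ⟨J, hJ, -, h⟩ := hG.exists_hyperplane W
  obtain ⟨e, he, rfl⟩ := hJ
  induction e with
  | _ a b => exact ⟨a, b, (h a b).2 (Parallel.refl he)⟩

theorem exists_wall_crosses {a b : V} (hab : G.Adj a b) :
    ∃ W : hG.wallspace.walls, Crosses G W a b := by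
  have hJ := isHyperplane_parallelClass (G := G) (e := s(a, b)) hab
  refine ⟨⟨halfspaces G (parallelClass G s(a, b)), hG.mem_walls_wallspace.2 ⟨_, hJ, rfl⟩⟩, hab,
    fun h => ?_⟩
  rw [halfspaceAt_halfspaces_eq_iff, hG.reachable_iff hab hJ] at h
  exact h (mem_parallelClass_self hab)

theorem wall_eq_of_crosses {U W : hG.wallspace.walls} {a b : V} (hU : Crosses G U a b)
    (hW : Crosses G W a b) : U = W := by
  obtain ⟨J, hJ, hJU, h⟩ := hG.exists_hyperplane U
  obtain ⟨K, hK, hKW, h'⟩ := hG.exists_hyperplane W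
  refine Subtype.ext ?_
  rw [hJU, hKW, hJ.eq_parallelClass ((h a b).1 hU), hK.eq_parallelClass ((h' a b).1 hW)]

theorem crosses_iff_parallel {W : hG.wallspace.walls} {a b c d : V} (h : Crosses G W a b) :
    Crosses G W c d ↔ Parallel G s(a, b) s(c, d) := by
  obtain ⟨J, hJ, -, h'⟩ := hG.exists_hyperplane W
  rw [h', hJ.eq_parallelClass ((h' a b).1 h)]
  rfl

theorem halfspaceAt_eq_of_not_crosses {W : hG.wallspace.walls} {a b : V} (hab : G.Adj a b)
    (h : ¬Crosses G W a b) : halfspaceAt W.1 a = halfspaceAt W.1 b := by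
  by_contra hne
  exact h ⟨hab, hne⟩

/-- Halfspaces are connected. -/
theorem reflTransGen_of_halfspaceAt_eq {W : hG.wallspace.walls} {x y : V}
    (h : halfspaceAt W.1 x = halfspaceAt W.1 y) :
    Relation.ReflTransGen (fun a b => G.Adj a b ∧ halfspaceAt W.1 a = halfspaceAt W.1 b) x y := by
  obtain ⟨J, hJ, hW, -⟩ := hG.exists_hyperplane W
  rw [hW] at h ⊢
  rw [halfspaceAt_halfspaces_eq_iff, SimpleGraph.reachable_iff_reflTransGen] at h
  refine Relation.ReflTransGen.mono (fun a b hab => ?_) _ _ h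
  refine ⟨(SimpleGraph.deleteEdges_adj.1 hab).1, ?_⟩
  rw [halfspaceAt_halfspaces_eq_iff]
  exact hab.reachable

theorem eq_of_forall_halfspaceAt_eq {x y : V}
    (h : ∀ W : hG.wallspace.walls, halfspaceAt W.1 x = halfspaceAt W.1 y) : x = y :=
  hG.eq_of_forall_reachable fun J hJ =>
    halfspaceAt_halfspaces_eq_iff.1 (h ⟨halfspaces G J, hG.mem_walls_wallspace.2 ⟨J, hJ, rfl⟩⟩)

open CubulationVertex

theorem differAt_canonicalMap {W : hG.wallspace.walls} {a b : V} (h : Crosses G W a b) :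
    DifferAt W (canonicalMap hG.wallspace a) (canonicalMap hG.wallspace b) := by
  refine ⟨h.2, fun U hU => ?_⟩
  rw [side_canonicalMap, side_canonicalMap]
  exact hG.halfspaceAt_eq_of_not_crosses h.1 fun h' => hU (hG.wall_eq_of_crosses h' h)

/-- The canonical map to the cubulation, as a graph homomorphism. -/
def canonicalHom : G →g cubulation hG.wallspace where
  toFun := canonicalMap hG.wallspace
  map_rel' := fun hab =>
    (hG.differAt_canonicalMap (hG.exists_wall_crosses hab).choose_spec).adj

theorem canonicalHom_injective : Function.Injective hG.canonicalHom := fun _ _ h =>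
  hG.eq_of_forall_halfspaceAt_eq fun W => congrArg (fun μ : CubulationVertex _ => μ.side W) h

/-- If two orientations differ exactly on the wall `J`, then a wall on which they do not agree
with the endpoints of an edge crossing `J` crosses `J` along a `4`-cycle. -/
theorem exists_fourCycle {J U : hG.wallspace.walls} {μ μ' : CubulationVertex hG.wallspace}
    (h : DifferAt J μ μ') {x x' : V} (hx : Crosses G J x x') (hUJ : U ≠ J)
    (hU : μ.side U ≠ halfspaceAt U.1 x) :
    ∃ Q : FourCycle G, Crosses G J Q.a Q.b ∧ Crosses G U Q.b Q.c := by
  by_contra! hcon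
  have hJU : ∀ {a b}, Crosses G J a b → halfspaceAt U.1 a = halfspaceAt U.1 b := fun hab =>
    hG.halfspaceAt_eq_of_not_crosses hab.1 fun h' => hUJ (hG.wall_eq_of_crosses h' hab)
  -- If no square along `J` crosses `U`, all edges of `J` stay on the side of `U` that contains `x`.
  have key : ∀ e, Relation.ReflTransGen (Opposite G) s(x, x') e → ∀ a b, e = s(a, b) →
      halfspaceAt U.1 a = halfspaceAt U.1 x := by
    intro e he
    induction he with
    | refl =>
      intro a b hab
      rw [Sym2.eq_iff] at hab
      rcases hab with ⟨rfl, rfl⟩ | ⟨rfl, rfl⟩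
      · rfl
      · exact (hJU hx).symm
    | tail hp ho ih =>
      intro a b hab
      obtain ⟨Q, rfl, rfl⟩ := ho
      have hQ : Crosses G J Q.a Q.b := (hG.crosses_iff_parallel hx).2 ⟨hx.1, Q.adj_ab, hp⟩
      have h1 := ih Q.a Q.b rfl
      have h2 : halfspaceAt U.1 Q.b = halfspaceAt U.1 Q.c :=
        hG.halfspaceAt_eq_of_not_crosses Q.adj_bc (hcon Q hQ)
      have h3 : Crosses G J Q.c Q.d :=
        (hG.crosses_iff_parallel hQ).2 (Opposite.parallel ⟨Q, rfl, rfl⟩)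
      have h4 := hJU h3
      have h5 := hJU hQ
      rw [Sym2.eq_iff] at hab
      rcases hab with ⟨rfl, rfl⟩ | ⟨rfl, rfl⟩
      · rw [← h2, ← h5, h1]
      · rw [← h4, ← h2, ← h5, h1]
  have hJx : ∀ {a b}, Crosses G J a b → halfspaceAt U.1 a = halfspaceAt U.1 x := fun hab =>
    key _ ((hG.crosses_iff_parallel hx).1 hab).2.2 _ _ rfl
  -- Both μ and μ' choose the side of `U` away from `x`, which therefore meets both sides of `J`.
  -- Being connected, it contains an edge of `J`: a contradiction.
  obtain ⟨p, hpU, hpJ⟩ := μ.1.inter U J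
  obtain ⟨q, hqU, hqJ⟩ := μ'.1.inter U J
  have hp : halfspaceAt U.1 p = μ.side U := Wallspace.halfspaceAt_eq_of_mem U (μ.side_mem U) hpU
  have hq : halfspaceAt U.1 q = μ.side U := by
    rw [h.2 U hUJ]
    exact Wallspace.halfspaceAt_eq_of_mem U (μ'.side_mem U) hqU
  have hpq := hG.reflTransGen_of_halfspaceAt_eq (hp.trans hq.symm)
  have : halfspaceAt J.1 p = halfspaceAt J.1 q ∧ halfspaceAt U.1 q = halfspaceAt U.1 p := by
    clear hqU hqJ hq
    induction hpq with
    | refl => exact ⟨rfl, rfl⟩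
    | tail _ hab ih =>
      refine ⟨ih.1.trans (hG.halfspaceAt_eq_of_not_crosses hab.1 fun hc => hU ?_),
        hab.2.symm.trans ih.2⟩
      rw [← hp, ← ih.2, hJx hc]
  have h1 : halfspaceAt J.1 p = μ.side J := Wallspace.halfspaceAt_eq_of_mem J (μ.side_mem J) hpJ
  have h2 : halfspaceAt J.1 q = μ'.side J :=
    Wallspace.halfspaceAt_eq_of_mem J (μ'.side_mem J) hqJ
  exact h.1 (h1 ▸ h2 ▸ this.1)

end IsSubmedian

end HyperplaneWallspace

/-! ### Extending a parallel-preserving map to the cubulation -/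

section Extension

open CubulationVertex

variable {V V' : Type*} {X : SimpleGraph V} {Y : SimpleGraph V'} (hX : IsSubmedian X)
  (ψ : X →g Y)

/-- The wall `W` is mapped by `ψ` to the hyperplane of the edge `uv`. -/
def ImageCrosses (W : hX.wallspace.walls) (u v : V') : Prop :=
  ∃ a b, Crosses X W a b ∧ Parallel Y s(u, v) s(ψ a, ψ b)

/-- The walls that separate `μ` from `x₀` and that `ψ` maps to the hyperplane of `uv`. -/
def separatingWalls (x₀ : V) (μ : CubulationVertex hX.wallspace) (u v : V') :
    Set hX.wallspace.walls :=
  {W | μ.side W ≠ halfspaceAt W.1 x₀ ∧ ImageCrosses hX ψ W u v}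

/-- The vertex `y` lies, with respect to every hyperplane of `Y`, on the side prescribed by the
walls separating `μ` from `x₀`. -/
def Extends (x₀ : V) (μ : CubulationVertex hX.wallspace) (y : V') : Prop :=
  ∀ u v, Y.Adj u v →
    ((y ∈ nearer Y u v ↔ ψ x₀ ∈ nearer Y u v) ↔ Even (separatingWalls hX ψ x₀ μ u v).ncard)

variable {hX ψ}

theorem imageCrosses_iff (hψ : ParallelPreserving ψ) {W : hX.wallspace.walls} {a b : V}
    (h : Crosses X W a b) {u v : V'} :
    ImageCrosses hX ψ W u v ↔ Parallel Y s(u, v) s(ψ a, ψ b) := by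
  refine ⟨fun ⟨c, d, h', hp⟩ => hp.trans ?_, fun hp => ⟨a, b, h, hp⟩⟩
  exact hψ _ _ ((hX.crosses_iff_parallel h').1 h)

theorem finite_separatingWalls (x₀ : V) (μ : CubulationVertex hX.wallspace) (u v : V') :
    (separatingWalls hX ψ x₀ μ u v).Finite :=
  (finite_side_ne μ (canonicalMap hX.wallspace x₀)).subset fun _ h => h.1

theorem even_separatingWalls_iff {x₀ : V} {J : hX.wallspace.walls}
    {μ μ' : CubulationVertex hX.wallspace} (h : DifferAt J μ μ') (u v : V') :
    (Even (separatingWalls hX ψ x₀ μ u v).ncard ↔ Even (separatingWalls hX ψ x₀ μ' u v).ncard) ↔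
      ¬ImageCrosses hX ψ J u v := by
  have key : ∀ {μ μ' : CubulationVertex hX.wallspace}, DifferAt J μ μ' →
      ImageCrosses hX ψ J u v → μ.side J = halfspaceAt J.1 x₀ →
      (separatingWalls hX ψ x₀ μ' u v).ncard = (separatingWalls hX ψ x₀ μ u v).ncard + 1 := by
    intro μ μ' h hJ hμ
    have hnot : J ∉ separatingWalls hX ψ x₀ μ u v := fun hmem => hmem.1 hμ
    rw [← Set.ncard_insert_of_notMem hnot (finite_separatingWalls x₀ μ u v)]
    congr 1
    ext W
    by_cases hW : W = J
    · subst hW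
      exact ⟨fun _ => Or.inl rfl, fun _ => ⟨fun h' => h.1 (hμ.trans h'.symm), hJ⟩⟩
    · constructor
      · intro hmem
        refine Or.inr ⟨?_, hmem.2⟩
        rw [h.2 W hW]
        exact hmem.1
      · rintro (hmem | hmem)
        · exact absurd hmem hW
        · refine ⟨?_, hmem.2⟩
          rw [← h.2 W hW]
          exact hmem.1
  by_cases hJ : ImageCrosses hX ψ J u v
  · refine iff_of_false ?_ (not_not.2 hJ)
    by_cases hμ : μ.side J = halfspaceAt J.1 x₀
    · rw [key h hJ hμ, Nat.even_add_one]
      tauto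
    · rw [key h.symm hJ (Wallspace.eq_of_ne_of_ne J (μ.side_mem J) (μ'.side_mem J)
        (halfspaceAt_mem _ J x₀).1 h.1 hμ), Nat.even_add_one]
      tauto
  · refine iff_of_true ?_ hJ
    have : separatingWalls hX ψ x₀ μ u v = separatingWalls hX ψ x₀ μ' u v := by
      ext W
      refine and_congr_left fun hW => ?_
      rw [h.2 W]
      rintro rfl
      exact hJ hW
    rw [this]

/-- Flipping `J` changes the parity, and moving from `y` to `y'` changes the side, for exactly one
hyperplane of `Y`: that of ψ(x)ψ(x'). -/
theorem Extends.of_differAt (hY : IsMedian Y) (hψ : ParallelPreserving ψ) {x₀ : V}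
    {J : hX.wallspace.walls} {μ μ' : CubulationVertex hX.wallspace} {y y' : V'} {x x' : V}
    (hy : Extends hX ψ x₀ μ y) (h : DifferAt J μ μ') (hx : Crosses X J x x')
    (hp : Parallel Y s(ψ x, ψ x') s(y, y')) : Extends hX ψ x₀ μ' y' := by
  intro u v huv
  have h1 := hy u v huv
  have h2 := even_separatingWalls_iff (ψ := ψ) (x₀ := x₀) h u v
  have h3 : ImageCrosses hX ψ J u v ↔ Parallel Y s(u, v) s(y, y') :=
    (imageCrosses_iff hψ hx).trans ⟨fun h => h.trans hp, fun h => h.trans hp.symm⟩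
  rw [h3, hY.parallel_iff huv hp.2.1, not_not, ← h1] at h2
  by_cases h4 : ψ x₀ ∈ nearer Y u v
  · simp only [h4, iff_true] at h2 ⊢
    by_cases h5 : y ∈ nearer Y u v <;> simp only [h5, true_iff, false_iff] at h2 <;> tauto
  · simp only [h4, iff_false] at h2 ⊢
    by_cases h5 : y ∈ nearer Y u v <;>
      simp only [h5, true_iff, false_iff, not_true, not_false_iff] at h2 <;> tauto

theorem extends_canonicalMap (hY : IsMedian Y) (hψ : ParallelPreserving ψ) (x₀ x : V) :
    Extends hX ψ x₀ (canonicalMap hX.wallspace x) (ψ x) := by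
  have hx := (SimpleGraph.reachable_iff_reflTransGen x₀ x).1 (hX.1.preconnected x₀ x)
  induction hx with
  | refl =>
    intro u v _
    have : separatingWalls hX ψ x₀ (canonicalMap hX.wallspace x₀) u v = ∅ :=
      Set.eq_empty_of_forall_notMem fun W hW => hW.1 rfl
    rw [this, Set.ncard_empty]
    exact iff_of_true Iff.rfl Even.zero
  | @tail y z _ hyz ih =>
    obtain ⟨W, hW⟩ := hX.exists_wall_crosses hyz
    exact ih.of_differAt hY hψ (hX.differAt_canonicalMap hW) hW (Parallel.refl (ψ.map_adj hyz))

theorem Extends.eq (hY : IsMedian Y) {x₀ : V} {μ : CubulationVertex hX.wallspace} {y z : V'}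
    (hy : Extends hX ψ x₀ μ y) (hz : Extends hX ψ x₀ μ z) : y = z := by
  by_contra hne
  obtain ⟨u, v, huv, h1, h2⟩ := exists_nearer_separating hY.1 hne
  have h3 := hy u v huv
  rw [← hz u v huv] at h3
  tauto

/-- The crux of existence. `Parallel` includes that `yy'` is an edge, so this provides the next
vertex of the path in `Y`. -/
theorem Extends.exists_adj (hY : IsMedian Y) (hψ : ParallelPreserving ψ) {x₀ : V}
    {J : hX.wallspace.walls} {μ μ' : CubulationVertex hX.wallspace} {y : V'} {x x' : V}
    (hy : Extends hX ψ x₀ μ y) (h : DifferAt J μ μ') (hx : Crosses X J x x') :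
    ∃ y', Parallel Y s(ψ x, ψ x') s(y, y') := by
  wlog hyx : y ∈ nearer Y (ψ x) (ψ x') generalizing x x'
  · rw [hY.notMem_nearer_iff (ψ.map_adj hx.1)] at hyx
    obtain ⟨y', hy'⟩ := this hx.symm hyx
    rw [Sym2.eq_swap] at hy'
    exact ⟨y', hy'⟩
  have hψx := ψ.map_adj hx.1
  obtain ⟨z, hyz, hz⟩ := hY.exists_adj_notMem_nearer hψx hyx fun u v huv hyu hxu => by
    have hnJ : ¬Parallel Y s(u, v) s(ψ x, ψ x') := by
      intro hp
      have hx'u : ψ x' ∈ nearer Y u v := by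
        by_contra hx'u
        exact (hY.parallel_iff huv hψx).1 hp (iff_of_false hxu hx'u)
      have heq := hY.nearer_eq_of_mem huv hψx.symm hx'u hxu
      rw [heq, ← hY.notMem_nearer_iff hψx] at hyu
      exact hyu hyx
    -- Otherwise μ and η(x) give the same parity for `uv`, and `y` and ψ(x) lie on the same side of
    -- it.
    have hex : ∃ U, ImageCrosses hX ψ U u v ∧ μ.side U ≠ halfspaceAt U.1 x := by
      by_contra! hcon
      have h1 := hy u v huv
      have h2 := extends_canonicalMap (hX := hX) hY hψ x₀ x u v huv
      have h3 : separatingWalls hX ψ x₀ μ u v =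
          separatingWalls hX ψ x₀ (canonicalMap hX.wallspace x) u v := by
        ext W
        refine and_congr_left fun hW => ?_
        rw [hcon W hW, side_canonicalMap]
      rw [h3, ← h2] at h1
      tauto
    obtain ⟨U, hUuv, hU⟩ := hex
    have hUJ : U ≠ J := by
      rintro rfl
      exact hnJ ((imageCrosses_iff hψ hx).1 hUuv)
    obtain ⟨Q, hQJ, hQU⟩ := hX.exists_fourCycle h hx hUJ hU
    have hJ : Parallel Y s(ψ x, ψ x') s(ψ Q.a, ψ Q.b) :=
      hψ _ _ ((hX.crosses_iff_parallel hx).1 hQJ)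
    have hQJ' : Crosses X J Q.d Q.c := (hX.crosses_iff_parallel hQJ).2 Q.opposite.parallel
    have hJ' : Parallel Y s(ψ x, ψ x') s(ψ Q.d, ψ Q.c) :=
      hψ _ _ ((hX.crosses_iff_parallel hx).1 hQJ')
    have hbc := (hY.parallel_iff huv (ψ.map_adj Q.adj_bc)).1 ((imageCrosses_iff hψ hQU).1 hUuv)
    -- In the image square, `ab` and `dc` cross the image of `J` but not the hyperplane of `uv`,
    -- which `bc` crosses. So one of these two sides lies in the halfspace of `u`, and one of its
    -- ends lies beyond the image of `J`.
    have hab : ψ Q.a ∈ nearer Y u v ↔ ψ Q.b ∈ nearer Y u v := by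
      by_contra hne
      exact hnJ (((hY.parallel_iff huv hJ.2.1).2 hne).trans hJ.symm)
    have hdc : ψ Q.d ∈ nearer Y u v ↔ ψ Q.c ∈ nearer Y u v := by
      by_contra hne
      exact hnJ (((hY.parallel_iff huv hJ'.2.1).2 hne).trans hJ'.symm)
    have hab' := (hY.parallel_iff hψx hJ.2.1).1 hJ
    have hdc' := (hY.parallel_iff hψx hJ'.2.1).1 hJ'
    by_cases hb : ψ Q.b ∈ nearer Y u v
    · by_cases hb' : ψ Q.b ∈ nearer Y (ψ x) (ψ x')
      · exact ⟨ψ Q.a, hab.2 hb, fun ha' => hab' (iff_of_true ha' hb')⟩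
      · exact ⟨ψ Q.b, hb, hb'⟩
    · have hc : ψ Q.c ∈ nearer Y u v := by
        by_contra hc
        exact hbc (iff_of_false hb hc)
      by_cases hc' : ψ Q.c ∈ nearer Y (ψ x) (ψ x')
      · exact ⟨ψ Q.d, hdc.2 hc, fun hd' => hdc' (iff_of_true hd' hc')⟩
      · exact ⟨ψ Q.c, hc, hc'⟩
  exact ⟨z, hY.parallel_of_mem_nearer hψx hyz hyx hz⟩

theorem exists_extends (hY : IsMedian Y) (hψ : ParallelPreserving ψ) (x₀ : V)
    (μ : CubulationVertex hX.wallspace) : ∃ y, Extends hX ψ x₀ μ y := by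
  have hμ := (SimpleGraph.reachable_iff_reflTransGen _ _).1
    (cubulation_preconnected hX.wallspace (canonicalMap hX.wallspace x₀) μ)
  induction hμ with
  | refl => exact ⟨ψ x₀, extends_canonicalMap hY hψ x₀ x₀⟩
  | tail _ hνμ ih =>
    obtain ⟨y, hy⟩ := ih
    obtain ⟨J, hJ⟩ := adj_iff_exists_differAt.1 hνμ
    obtain ⟨x, x', hx⟩ := hX.exists_crosses J
    obtain ⟨y', hy'⟩ := hy.exists_adj hY hψ hJ hx
    exact ⟨y', hy.of_differAt hY hψ hJ hx hy'⟩

theorem IsSubmedian.exists_extension (hX : IsSubmedian X) (hY : IsMedian Y)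
    (hψ : ParallelPreserving ψ) :
    ∃ ξ : cubulation hX.wallspace →g Y, ParallelPreserving ξ ∧ ψ = ξ.comp hX.canonicalHom := by
  obtain ⟨x₀⟩ := hX.1.nonempty
  choose ξ hξ using exists_extends (hX := hX) hY hψ x₀
  -- The hyperplane of ξ(μ)ξ(μ') depends only on the flipped wall, whence parallel-preservation.
  have hpar : ∀ {J μ μ' x x'}, DifferAt J μ μ' → Crosses X J x x' →
      Parallel Y s(ψ x, ψ x') s(ξ μ, ξ μ') := by
    intro J μ μ' x x' hJ hx
    obtain ⟨y', hy'⟩ := (hξ μ).exists_adj hY hψ hJ hx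
    rw [(hξ μ').eq hY ((hξ μ).of_differAt hY hψ hJ hx hy')]
    exact hy'
  refine ⟨⟨ξ, fun hμ => ?_⟩, fun e e' he => ?_, ?_⟩
  · obtain ⟨J, hJ⟩ := adj_iff_exists_differAt.1 hμ
    obtain ⟨x, x', hx⟩ := hX.exists_crosses J
    exact (hpar hJ hx).2.1
  · induction e with
    | _ μ μ' =>
      induction e' with
      | _ ν ν' =>
        obtain ⟨J, hJ⟩ := adj_iff_exists_differAt.1 (show (cubulation _).Adj μ μ' from he.1)
        obtain ⟨x, x', hx⟩ := hX.exists_crosses J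
        exact (hpar hJ hx).symm.trans (hpar (differAt_of_parallel he hJ) hx)
  · ext x
    exact (extends_canonicalMap hY hψ x₀ x).eq hY (hξ _)

theorem IsSubmedian.extension_unique (hX : IsSubmedian X) (hY : IsMedian Y)
    {ξ ξ' : cubulation hX.wallspace →g Y} (hξ : ParallelPreserving ξ)
    (hξ' : ParallelPreserving ξ') (h : ξ.comp hX.canonicalHom = ξ'.comp hX.canonicalHom) :
    ξ = ξ' := by
  have hη : ∀ x, ξ (canonicalMap hX.wallspace x) = ξ' (canonicalMap hX.wallspace x) :=
    fun x => congrArg (fun f : X →g Y => f x) h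
  obtain ⟨x₀⟩ := hX.1.nonempty
  ext μ
  have hμ := (SimpleGraph.reachable_iff_reflTransGen _ _).1
    (cubulation_preconnected hX.wallspace (canonicalMap hX.wallspace x₀) μ)
  induction hμ with
  | refl => exact hη x₀
  | @tail μ ν _ hμν ih =>
    obtain ⟨J, hJ⟩ := adj_iff_exists_differAt.1 hμν
    obtain ⟨x, x', hx⟩ := hX.exists_crosses J
    -- The edge μν is parallel to an edge of η(X), on which ξ and ξ' agree; so both send ν across
    -- the same hyperplane from the same vertex.
    have hp := parallel_of_differAt hJ (hX.differAt_canonicalMap hx)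
    have h1 : Parallel Y s(ξ μ, ξ ν) _ := hξ _ _ hp
    have h2 : Parallel Y s(ξ' μ, ξ' ν) _ := hξ' _ _ hp
    rw [Sym2.map_mk] at h1 h2
    simp only [hη] at h1
    rw [← ih] at h2
    exact hY.eq_of_parallel (ξ.map_adj hμν) (h1.trans h2.symm)

end Extension

end MedianGraph

theorem proposition3 {V V' : Type*} (X : SimpleGraph V) (Y : SimpleGraph V')
    (hX : MedianGraph.IsSubmedian X) (hY : MedianGraph.IsMedian Y)
    (ψ : X →g Y) (hψ : MedianGraph.ParallelPreserving ψ) :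
    ∃ ω : MedianGraph.Wallspace V, ω.walls = MedianGraph.hyperplaneWalls X ∧
      ∃ η : X →g MedianGraph.cubulation ω,
        (∀ x, η x = MedianGraph.canonicalMap ω x) ∧ Function.Injective η ∧
        ∃! ξ : MedianGraph.cubulation ω →g Y,
          MedianGraph.ParallelPreserving ξ ∧ ψ = ξ.comp η := by
  refine ⟨hX.wallspace, rfl, hX.canonicalHom, fun _ => rfl, hX.canonicalHom_injective, ?_⟩
  obtain ⟨ξ, hξ, h⟩ := hX.exists_extension hY hψ
  exact ⟨ξ, ⟨hξ, h⟩, fun ξ' h' => hX.extension_unique hY h'.1 hξ (h'.2.symm.trans h)⟩
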